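/- Let $\Bbbk$ be a field of characteristic zero. A conformal (super)algebra over $\Bbbk$ is a ($\mathbb Z_2$-graded) $\Bbbk[\partial]$-module $C$ with even bilinear products $(x_{(n)}y)$, $n\ge 0$, such that for all $x,y$ one has $x_{(n)}y=0$ for $n\gg 0$, $(\partial x)_{(n)}y=-n\,x_{(n-1)}y$ and $x_{(n)}\partial y=\partial(x_{(n)}y)+n\,x_{(n-1)}y$; put $(x_\lambda y)=\sum_{n\ge0}\frac{\lambda^n}{n!}(x_{(n)}y)$. It is associative if $x_{(n)}(y_{(m)}z)=\sum_{s\ge0}\binom ns (x_{(s)}y)_{(n+m-s)}z$. On an associative conformal superalgebra $C$ let $C^{(-)}$ carry the brackets $[x_{(n)}y]=x_{(n)}y-(-1)^{|x||y|}\sum_{s\ge0}\frac{(-1)^{n+s}}{s!}\partial^s(y_{(n+s)}x)$ for homogeneous $x,y$. Let $K_1$ be the Neveu--Schwartz Lie conformal superalgebra: the free $\Bbbk[\partial]$-module with basis $X=\{v,g\}$, $|v|=0$, $|g|=1$, and brackets $$[v_\lambda v]=(\partial+2\lambda)v,\qquad [g_\lambda v]=\left(\tfrac12\partial+\tfrac32\lambda\right)g,\qquad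 [g_\lambda g]=-\tfrac12 v,$$ and hence, by skew-symmetry, $[v_\lambda g]=(\partial+\tfrac32\lambda)g$. Let $N(v,v)=3$ and $N(v,g)=N(g,v)=N(g,g)=2$. Let $U=U(K_1;X,N)$, with $\iota:K_1\to U^{(-)}$, be the universal associative conformal envelope of $K_1$ relative to $N$, that is, the universal one among the pairs $(C,\varphi)$ where $C$ is an associative conformal superalgebra and $\varphi:K_1\to C^{(-)}$ is a homomorphism of conformal superalgebras whose image generates $C$, with $\varphi(x)_{(n)}\varphi(y)=0$ for all $x,y\in X$ and $n\ge N(x,y)$. It exists: it is the algebra presented by generators and relations that these conditions describe. Write $x$ also for $\iota(x)$, $x\in X$, and let $L_n^x$ be the operator $f\mapsto x_{(n)}f$ on $U$. 1. The words $$(L_0^v)^n\partial^s x,\qquad (L_0^v)^nL_0^g\,\partial^s x,\qquad (L_0^v)^nL_1^x g\qquad(n,s\ge0,\ x\in X)$$ are pairwise distinct and form a $\Bbbk$-linear basis of $U$. 2. Let $\mathrm{Cend}_2$ be the space of $2\times2$ matrices over $\Bbbk[\partial,x]$ with the product $(F_\lambda G)=F(-\lambda,x)\,G(\partial+\lambda,x+\lambda)$,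 graded so that diagonal matrices are even and off-diagonal ones odd. There is an injective homomorphism of conformal superalgebras $U\to\mathrm{Cend}_2$ with $$v\mapsto\begin{pmatrix}x&0\\0&x-\frac12\partial\end{pmatrix},\qquad g\mapsto\frac12\begin{pmatrix}0&x\\-1&0\end{pmatrix},$$ and its image is the set of all matrices $\begin{pmatrix}xf_{11}&xf_{12}\\f_{21}&f_{22}\end{pmatrix}$ with $f_{ij}\in\Bbbk[\partial,x]$. -/

import Mathlib

open Polynomial

universe u

/-! ### Conformal superalgebras -/

/-- The operations of a `ℤ/2`-graded conformal algebra over `k`: a derivation `∂` (so that `C` is a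
module over `H = k[∂]`), the bilinear `n`-products `x (n) y`, and the even and odd parts. -/
class ConformalData (k : Type u) (C : Type u) [Field k] [AddCommGroup C] [Module k C] where
  /-- the operator `∂` -/
  D : C →ₗ[k] C
  /-- the `n`-th product -/
  mul : ℕ → C →ₗ[k] C →ₗ[k] C
  /-- the homogeneous components -/
  parity : ZMod 2 → Submodule k C

section Operations

variable (k : Type u) {C : Type u} [Field k] [AddCommGroup C] [Module k C] [ConformalData k C]

/-- The operator `∂`. -/
abbrev del : C →ₗ[k] C := ConformalData.D

/-- The `n`-th product. -/
abbrev nprod (n : ℕ) : C →ₗ[k] C →ₗ[k] C := ConformalData.mul n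

/-- The homogeneous components. -/
abbrev parity (i : ZMod 2) : Submodule k C := ConformalData.parity i

end Operations

/-- The sign `(-1)^{ij}`. -/
def superSign (k : Type u) [Field k] (i j : ZMod 2) : k := if i = 1 ∧ j = 1 then -1 else 1

section Laws

variable (k : Type u) (C : Type u) [Field k] [AddCommGroup C] [Module k C] [ConformalData k C]

/-- The axioms shared by conformal superalgebras: locality, sesquilinearity and
compatibility with the grading. -/
structure IsConformalSuperalgebra : Prop where
  locality : ∀ x y : C, ∃ M : ℕ, ∀ n, M ≤ n → nprod k n x y = 0
  D_mul : ∀ (n : ℕ) (x y : C), nprod k n (del k x) y =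
    -((n : k) • nprod k (n - 1) x y)
  mul_D : ∀ (n : ℕ) (x y : C), nprod k n x (del k y) =
    del k (nprod k n x y) +
      (n : k) • nprod k (n - 1) x y
  isCompl : IsCompl (parity k 0 : Submodule k C) (parity k 1)
  D_mem : ∀ (i : ZMod 2) (x : C), x ∈ parity k i →
    del k x ∈ parity k i
  mul_mem : ∀ (i j : ZMod 2) (n : ℕ) (x y : C), x ∈ parity k i →
    y ∈ parity k j → nprod k n x y ∈ parity k (i + j)

/-- Associative conformal superalgebras. -/
structure IsAssocConformal : Prop extends IsConformalSuperalgebra k C where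
  assoc : ∀ (n m : ℕ) (x y z : C),
    nprod k n x (nprod k m y z) =
      ∑ s ∈ Finset.range (n + 1), (n.choose s : k) •
        nprod k (n + m - s) (nprod k s x y) z

variable {C}

/-- `{x (n) y} = ∑_{s ≥ 0} (-1)^{n+s} (∂^s / s!) (x (n+s) y)`; in a conformal algebra the sum is
finite by locality. -/
noncomputable def curly (n : ℕ) (x y : C) : C :=
  ∑ᶠ s : ℕ, ((-1 : k) ^ (n + s) / (s.factorial : k)) •
    ((del k : C →ₗ[k] C) ^ s) (nprod k (n + s) x y)

end Laws

section Envelopes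

variable (k : Type u) [Field k]

/-- Homomorphisms of conformal superalgebras: even linear maps preserving `∂` and all products. -/
structure IsConformalHom {C C' : Type u} [AddCommGroup C] [Module k C] [ConformalData k C]
    [AddCommGroup C'] [Module k C'] [ConformalData k C'] (f : C →ₗ[k] C') : Prop where
  map_D : ∀ x, f (del k x) = del k (f x)
  map_mul : ∀ n x y, f (nprod k n x y) =
    nprod k n (f x) (f y)
  map_parity : ∀ i x, x ∈ parity k i → f x ∈ parity k i

/-- `(C, φ)` is an associative envelope of the Lie conformal superalgebra `L` (its `n`-th product is
the bracket `[a (n) b]`) whose locality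
function on the family `x` is bounded by `N`: `C` is an associative conformal superalgebra,
`φ : L → C^{(-)}` is a homomorphism to the algebra `C` with the super-commutators
`(a (n) b) - (-1)^{|a||b|} {b (n) a}`, the image of `φ` generates `C`, and
`φ (x i) (n) φ (x j) = 0` for `n ≥ N i j`. -/
structure IsEnvelope {L : Type u} {I : Type} [AddCommGroup L] [Module k L] [ConformalData k L]
    (x : I → L) (N : I → I → ℕ)
    {C : Type u} [AddCommGroup C] [Module k C] [ConformalData k C] (φ : L →ₗ[k] C) : Prop where
  assoc : IsAssocConformal k C
  map_D : ∀ a, φ (del k a) = del k (φ a)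
  map_parity : ∀ i a, a ∈ parity k i → φ a ∈ parity k i
  map_bracket : ∀ (i j : ZMod 2) (n : ℕ) (a b : L), a ∈ parity k i →
    b ∈ parity k j → φ (nprod k n a b) =
      nprod k n (φ a) (φ b) - superSign k i j • curly k n (φ b) (φ a)
  generates : ∀ S : Submodule k C, (∀ a, φ a ∈ S) → (∀ c ∈ S, del k c ∈ S) →
    (∀ n, ∀ c ∈ S, ∀ c' ∈ S, nprod k n c c' ∈ S) → S = ⊤
  locality : ∀ i j n, N i j ≤ n → nprod k n (φ (x i)) (φ (x j)) = 0

/-- `(U, ι)` is the universal associative envelope of `L` relative to the locality bound `N` on the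
family `x`. -/
def IsUniversalEnvelope {L : Type u} {I : Type} [AddCommGroup L] [Module k L] [ConformalData k L]
    (x : I → L) (N : I → I → ℕ)
    {U : Type u} [AddCommGroup U] [Module k U] [ConformalData k U] (ι : L →ₗ[k] U) : Prop :=
  IsEnvelope k x N ι ∧
    ∀ (C : Type u) [AddCommGroup C] [Module k C] [ConformalData k C] (φ : L →ₗ[k] C),
      IsEnvelope k x N φ → ∃! f : U →ₗ[k] C, IsConformalHom k f ∧ f ∘ₗ ι = φ

/-! ### Construction of the universal envelope by generators and relations -/

/-- Formal monomials in the elements of `L`, the unary operation `∂` and the `n`-products. -/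
inductive ConfMonomial (L : Type u) : Type u
  | of (a : L) : ConfMonomial L
  | D (m : ConfMonomial L) : ConfMonomial L
  | mul (n : ℕ) (m m' : ConfMonomial L) : ConfMonomial L

/-- The free nonassociative algebra with a linear operator `∂` and bilinear `n`-products. -/
abbrev FreeConf (L : Type u) : Type u := ConfMonomial L →₀ k

namespace FreeConf

variable {k} {L : Type u}

/-- A generator. -/
noncomputable def of (a : L) : FreeConf k L := Finsupp.single (ConfMonomial.of a) 1

/-- The linear extension of `∂`. -/
noncomputable def D : FreeConf k L →ₗ[k] FreeConf k L := Finsupp.lmapDomain k k ConfMonomial.D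

/-- The bilinear extension of the `n`-th product. -/
noncomputable def mul (n : ℕ) : FreeConf k L →ₗ[k] FreeConf k L →ₗ[k] FreeConf k L :=
  Finsupp.lsum k fun m => LinearMap.toSpanSingleton k _
    (Finsupp.lmapDomain k k (ConfMonomial.mul n m))

end FreeConf

/-- Homogeneous monomials. -/
inductive ConfMonomial.HasParity {L : Type u} [AddCommGroup L] [Module k L] [ConformalData k L] :
    ConfMonomial L → ZMod 2 → Prop
  | of (i : ZMod 2) (a : L) (ha : a ∈ parity k i) : HasParity (.of a) i
  | D (i : ZMod 2) (m : ConfMonomial L) (hm : HasParity m i) : HasParity (.D m) i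
  | mul (i j : ZMod 2) (n : ℕ) (m m' : ConfMonomial L) (hm : HasParity m i)
      (hm' : HasParity m' j) : HasParity (.mul n m m') (i + j)

section Construction

variable {k} {L : Type u} {I : Type} [AddCommGroup L] [Module k L] [ConformalData k L]
  (x : I → L) (p : I → ZMod 2) (N : I → I → ℕ)

/-- The defining relations `r = 0` of the universal envelope of `L`, where `L` is generated over
`k[∂]` by the family `x` of homogeneous elements of parities `p`. In `commutator` the sum is that of
`{x j (n) x i}`, truncated by the locality bound. -/
inductive EnvelopeRel : FreeConf k L → Prop
  | of_add (a b : L) : EnvelopeRel (FreeConf.of (a + b) - (FreeConf.of a + FreeConf.of b))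
  | of_smul (c : k) (a : L) : EnvelopeRel (FreeConf.of (c • a) - c • FreeConf.of a)
  | of_D (a : L) : EnvelopeRel (FreeConf.of (del k a) - FreeConf.D (FreeConf.of a))
  | D_mul (n : ℕ) (a b : FreeConf k L) : EnvelopeRel
      (FreeConf.mul n (FreeConf.D a) b + (n : k) • FreeConf.mul (n - 1) a b)
  | mul_D (n : ℕ) (a b : FreeConf k L) : EnvelopeRel (FreeConf.mul n a (FreeConf.D b) -
      (FreeConf.D (FreeConf.mul n a b) + (n : k) • FreeConf.mul (n - 1) a b))
  | assoc (n m : ℕ) (a b c : FreeConf k L) : EnvelopeRel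
      (FreeConf.mul n a (FreeConf.mul m b c) - ∑ s ∈ Finset.range (n + 1),
        (n.choose s : k) • FreeConf.mul (n + m - s) (FreeConf.mul s a b) c)
  | locality (i j : I) (n : ℕ) (h : N i j ≤ n) : EnvelopeRel
      (FreeConf.mul n (FreeConf.of (x i)) (FreeConf.of (x j)))
  | commutator (i j : I) (n : ℕ) : EnvelopeRel
      (FreeConf.of (nprod k n (x i) (x j)) -
        (FreeConf.mul n (FreeConf.of (x i)) (FreeConf.of (x j)) -
          superSign k (p i) (p j) • ∑ s ∈ Finset.range (N j i),
            ((-1 : k) ^ (n + s) / (s.factorial : k)) •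
              (FreeConf.D ^ s) (FreeConf.mul (n + s) (FreeConf.of (x j)) (FreeConf.of (x i)))))

/-- The subspaces of `FreeConf k L` that contain the relations and are stable under `∂` and under
left and right products with arbitrary elements. -/
def IsEnvelopeIdeal (S : Submodule k (FreeConf k L)) : Prop :=
  (∀ r, EnvelopeRel x p N r → r ∈ S) ∧ (∀ r ∈ S, FreeConf.D r ∈ S) ∧
    ∀ (n : ℕ) (a : FreeConf k L), ∀ r ∈ S, FreeConf.mul n a r ∈ S ∧ FreeConf.mul n r a ∈ S

variable (k) in
/-- The ideal generated by the relations. -/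
noncomputable def envelopeIdeal : Submodule k (FreeConf k L) := sInf {S | IsEnvelopeIdeal x p N S}

variable (k) in
theorem isEnvelopeIdeal_envelopeIdeal : IsEnvelopeIdeal x p N (envelopeIdeal k x p N) := by
  refine ⟨fun r hr => ?_, fun r hr => ?_, fun n a r hr => ⟨?_, ?_⟩⟩ <;>
    refine Submodule.mem_sInf.2 fun S hS => ?_
  · exact hS.1 r hr
  · exact hS.2.1 r (Submodule.mem_sInf.1 hr S hS)
  · exact (hS.2.2 n a r (Submodule.mem_sInf.1 hr S hS)).1
  · exact (hS.2.2 n a r (Submodule.mem_sInf.1 hr S hS)).2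

variable (k) in
/-- The universal associative envelope `U(L; X, N)`. -/
abbrev Envelope : Type u := FreeConf k L ⧸ envelopeIdeal k x p N

noncomputable instance : ConformalData k (Envelope k x p N) where
  D := (envelopeIdeal k x p N).mapQ (envelopeIdeal k x p N) FreeConf.D
    fun r hr => (isEnvelopeIdeal_envelopeIdeal k x p N).2.1 r hr
  mul n := (envelopeIdeal k x p N).liftQ
    { toFun := fun a => (envelopeIdeal k x p N).mapQ (envelopeIdeal k x p N) (FreeConf.mul n a)
        fun r hr => ((isEnvelopeIdeal_envelopeIdeal k x p N).2.2 n a r hr).1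
      map_add' := fun a b => by
        ext : 1
        simp [LinearMap.ext_iff]
      map_smul' := fun c a => by
        ext : 1
        simp [LinearMap.ext_iff] }
    fun r hr => by
      rw [LinearMap.mem_ker]
      ext b
      exact (Submodule.Quotient.mk_eq_zero _).2
        (((isEnvelopeIdeal_envelopeIdeal k x p N).2.2 n _ r hr).2)
  parity i := (Submodule.span k
    {a : FreeConf k L | ∃ m : ConfMonomial L, m.HasParity k i ∧ a = Finsupp.single m 1}).map
      (envelopeIdeal k x p N).mkQ

variable (k) in
/-- The canonical map `L → U(L; X, N)`. -/
noncomputable def Envelope.ι : L →ₗ[k] Envelope k x p N where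
  toFun a := Submodule.Quotient.mk (FreeConf.of a)
  map_add' a b := (Submodule.Quotient.eq _).2
    ((isEnvelopeIdeal_envelopeIdeal k x p N).1 _ (EnvelopeRel.of_add a b))
  map_smul' c a := (Submodule.Quotient.eq _).2
    ((isEnvelopeIdeal_envelopeIdeal k x p N).1 _ (EnvelopeRel.of_smul c a))

end Construction

end Envelopes

/-! ### The Neveu–Schwartz conformal superalgebra `K₁` -/

section K1

variable (k : Type u) [Field k]

/-- The free `k[∂]`-module with basis `v = (1, 0)`, `g = (0, 1)`. -/
abbrev K1 : Type u := k[X] × k[X]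

variable {k} in
/-- For `a(∂) x`, `b(∂) y` and `[x_λ y] = c(∂, λ) z`, the coefficient
`a(-λ) b(∂ + λ) c(∂, λ) ∈ k[∂][λ]` of `z` in `[(a x)_λ (b y)]`. -/
noncomputable def sesqui (c : k[X][X]) (a b : k[X]) : k[X][X] :=
  eval₂ (C.comp C) (-X) a * eval₂ (C.comp C) (C X + X) b * c

variable {k} in
/-- The bracket of `K₁`, an element of `k[∂][λ] v ⊕ k[∂][λ] g`: the sesquilinear extension of
`[v_λ v] = (∂ + 2λ) v`, `[g_λ v] = (∂/2 + 3λ/2) g`, `[g_λ g] = -v/2` and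
`[v_λ g] = -[g_{-∂-λ} v] = (∂ + 3λ/2) g`. -/
noncomputable def K1.lambdaBracket (a b : K1 k) : k[X][X] × k[X][X] :=
  (sesqui (C X + 2 * X) a.1 b.1 + sesqui (C (C (-1 / 2))) a.2 b.2,
    sesqui (C X + C (C (3 / 2)) * X) a.1 b.2 +
      sesqui (C (C (1 / 2)) * C X + C (C (3 / 2)) * X) a.2 b.1)

theorem sesqui_add_left (c : k[X][X]) (a a' b : k[X]) :
    sesqui c (a + a') b = sesqui c a b + sesqui c a' b := by
  simp only [sesqui, eval₂_add]; ring

theorem sesqui_add_right (c : k[X][X]) (a b b' : k[X]) :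
    sesqui c a (b + b') = sesqui c a b + sesqui c a b' := by
  simp only [sesqui, eval₂_add]; ring

theorem sesqui_smul_left (c : k[X][X]) (r : k) (a b : k[X]) :
    sesqui c (r • a) b = r • sesqui c a b := by
  simp only [sesqui, smul_eq_C_mul, eval₂_mul, eval₂_C, RingHom.comp_apply]
  rw [← algebraMap_smul k[X] r (_ : k[X][X])]
  simp only [smul_eq_C_mul, algebraMap_eq]; ring

theorem sesqui_smul_right (c : k[X][X]) (r : k) (a b : k[X]) :
    sesqui c a (r • b) = r • sesqui c a b := by
  simp only [sesqui, smul_eq_C_mul, eval₂_mul, eval₂_C, RingHom.comp_apply]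
  rw [← algebraMap_smul k[X] r (_ : k[X][X])]
  simp only [smul_eq_C_mul, algebraMap_eq]; ring

theorem K1.lambdaBracket_add_left (a a' b : K1 k) :
    K1.lambdaBracket (a + a') b = K1.lambdaBracket a b + K1.lambdaBracket a' b := by
  simp only [K1.lambdaBracket, Prod.fst_add, Prod.snd_add, sesqui_add_left, Prod.mk_add_mk]
  ext1 <;> dsimp only <;> abel

theorem K1.lambdaBracket_add_right (a b b' : K1 k) :
    K1.lambdaBracket a (b + b') = K1.lambdaBracket a b + K1.lambdaBracket a b' := by
  simp only [K1.lambdaBracket, Prod.fst_add, Prod.snd_add, sesqui_add_right, Prod.mk_add_mk]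
  ext1 <;> dsimp only <;> abel

theorem K1.lambdaBracket_smul_left (r : k) (a b : K1 k) :
    K1.lambdaBracket (r • a) b = r • K1.lambdaBracket a b := by
  simp only [K1.lambdaBracket, Prod.smul_fst, Prod.smul_snd, sesqui_smul_left, Prod.smul_mk,
    smul_add]

theorem K1.lambdaBracket_smul_right (r : k) (a b : K1 k) :
    K1.lambdaBracket a (r • b) = r • K1.lambdaBracket a b := by
  simp only [K1.lambdaBracket, Prod.smul_fst, Prod.smul_snd, sesqui_smul_right, Prod.smul_mk,
    smul_add]

variable {k} in
/-- The `n`-th product: `n!` times the coefficient of `λ^n` in the `λ`-bracket. -/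
noncomputable def K1.bracket (n : ℕ) (a b : K1 k) : K1 k :=
  (n.factorial : k) • ((K1.lambdaBracket a b).1.coeff n, (K1.lambdaBracket a b).2.coeff n)

noncomputable instance K1.conformalData : ConformalData k (K1 k) where
  D := LinearMap.mulLeft k ((X, X) : k[X] × k[X])
  mul n := LinearMap.mk₂ k (K1.bracket n)
    (fun a a' b => by
      simp only [K1.bracket, K1.lambdaBracket_add_left, Prod.fst_add, Prod.snd_add, coeff_add,
        ← Prod.mk_add_mk, smul_add])
    (fun r a b => by
      simp only [K1.bracket, K1.lambdaBracket_smul_left, Prod.smul_fst, Prod.smul_snd, coeff_smul,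
        ← Prod.smul_mk, smul_comm _ r])
    (fun a b b' => by
      simp only [K1.bracket, K1.lambdaBracket_add_right, Prod.fst_add, Prod.snd_add, coeff_add,
        ← Prod.mk_add_mk, smul_add])
    (fun r a b => by
      simp only [K1.bracket, K1.lambdaBracket_smul_right, Prod.smul_fst, Prod.smul_snd, coeff_smul,
        ← Prod.smul_mk, smul_comm _ r])
  parity i := if i = 0 then LinearMap.ker (LinearMap.snd k k[X] k[X])
    else LinearMap.ker (LinearMap.fst k k[X] k[X])

/-- Labels of the generators `v`, `g` of `K₁`. -/
inductive K1Gen : Type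
  | v : K1Gen
  | g : K1Gen

/-- The generators `v`, `g` of `K₁`. -/
noncomputable def K1.gen : K1Gen → K1 k
  | .v => (1, 0)
  | .g => (0, 1)

/-- The parities `|v| = 0`, `|g| = 1`. -/
def K1Gen.parity : K1Gen → ZMod 2
  | .v => 0
  | .g => 1

/-- The locality bound `N(v, v) = 3`, `N(v, g) = N(g, v) = N(g, g) = 2`. -/
def K1Gen.N : K1Gen → K1Gen → ℕ
  | .v, .v => 3
  | _, _ => 2

/-- The universal associative envelope `U(K₁; {v, g}, N)`. -/
abbrev K1Envelope : Type u := Envelope k (K1.gen k) K1Gen.parity K1Gen.N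

/-- The canonical map `K₁ → U(K₁; {v, g}, N)`. -/
noncomputable abbrev K1Envelope.ι : K1 k →ₗ[k] K1Envelope k :=
  Envelope.ι k (K1.gen k) K1Gen.parity K1Gen.N

/-- The image of a generator in the envelope. -/
noncomputable def K1Envelope.gen (x : K1Gen) : K1Envelope k := K1Envelope.ι k (K1.gen k x)

/-- The operator `L_n^x : f ↦ x (n) f`. -/
noncomputable def K1Envelope.L (n : ℕ) (x : K1Gen) : K1Envelope k →ₗ[k] K1Envelope k :=
  nprod k n (K1Envelope.gen k x)

/-- Labels of the words `(L_0^v)^n ∂^s x`, `(L_0^v)^n L_0^g ∂^s x`, `(L_0^v)^n L_1^x g`. -/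
inductive K1Word : Type
  | plain (n s : ℕ) (x : K1Gen) : K1Word
  | withL0g (n s : ℕ) (x : K1Gen) : K1Word
  | withL1 (n : ℕ) (x : K1Gen) : K1Word

/-- The element of the envelope that a word denotes. -/
noncomputable def K1Word.eval : K1Word → K1Envelope k
  | .plain n s x => (K1Envelope.L k 0 .v ^ n) ((del k ^ s) (K1Envelope.gen k x))
  | .withL0g n s x =>
    (K1Envelope.L k 0 .v ^ n) (K1Envelope.L k 0 .g ((del k ^ s) (K1Envelope.gen k x)))
  | .withL1 n x => (K1Envelope.L k 0 .v ^ n) (K1Envelope.L k 1 x (K1Envelope.gen k .g))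

end K1

/-! ### The associative conformal superalgebra `Cend₂` -/

section Cend2

variable (k : Type u) [Field k]

/-- `2 × 2` matrices over `k[x][∂]`: the inner variable is `x`, the outer one is `∂`. -/
abbrev Cend2 : Type u := Matrix (Fin 2) (Fin 2) k[X][X]

variable {k}

/-- `f(∂, x) ↦ f(-λ, x)`, with values in `k[x][∂][λ]`. -/
noncomputable def evalNegLambda : k[X][X] →+* k[X][X][X] :=
  eval₂RingHom (S := k[X][X][X]) (C.comp C) (-X)

/-- `f(∂, x) ↦ f(∂ + λ, x + λ)`, with values in `k[x][∂][λ]`. -/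
noncomputable def shiftLambda : k[X][X] →+* k[X][X][X] :=
  eval₂RingHom (S := k[X][X][X])
    (eval₂RingHom (S := k[X][X][X]) (C.comp (C.comp C)) (C (C X) + X)) (C X + X)

/-- The `λ`-product `F(-λ, x) G(∂ + λ, x + λ)`. -/
noncomputable def Cend2.lambdaProduct (F G : Cend2 k) : Matrix (Fin 2) (Fin 2) k[X][X][X] :=
  F.map evalNegLambda * G.map shiftLambda

/-- The `n`-th product: `n!` times the coefficient of `λ^n` in the `λ`-product. -/
noncomputable def Cend2.nthProduct (n : ℕ) (F G : Cend2 k) : Cend2 k :=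
  Matrix.of fun i j => (n.factorial : k) • (Cend2.lambdaProduct F G i j).coeff n

theorem smul_eq_C_C_mul (r : k) (f : k[X][X]) : r • f = C (C r) * f := by
  rw [← algebraMap_smul k[X] r f, smul_eq_C_mul]; rfl

theorem smul_eq_C_C_C_mul (r : k) (f : k[X][X][X]) : r • f = C (C (C r)) * f := by
  rw [← algebraMap_smul k[X] r f, ← algebraMap_smul k[X][X] _ f, smul_eq_C_mul]; rfl

theorem evalNegLambda_smul (r : k) (f : k[X][X]) :
    evalNegLambda (r • f) = r • evalNegLambda f := by
  rw [smul_eq_C_C_mul, smul_eq_C_C_C_mul, map_mul]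
  simp [evalNegLambda]

theorem shiftLambda_smul (r : k) (f : k[X][X]) : shiftLambda (r • f) = r • shiftLambda f := by
  rw [smul_eq_C_C_mul, smul_eq_C_C_C_mul, map_mul]
  simp [shiftLambda]

variable (k)

noncomputable instance Cend2.conformalData : ConformalData k (Cend2 k) where
  D := LinearMap.mulLeft k (Matrix.diagonal fun _ => X)
  mul n := LinearMap.mk₂ k (Cend2.nthProduct n)
    (fun F F' G => by
      ext1 i j
      simp only [Cend2.nthProduct, Cend2.lambdaProduct, Matrix.mul_apply, Matrix.map_apply,
        Matrix.of_apply, Matrix.add_apply, map_add, add_mul, Finset.sum_add_distrib, coeff_add,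
        smul_add])
    (fun r F G => by
      ext1 i j
      simp only [Cend2.nthProduct, Cend2.lambdaProduct, Matrix.mul_apply, Matrix.map_apply,
        Matrix.of_apply, Matrix.smul_apply, evalNegLambda_smul, smul_mul_assoc, ← Finset.smul_sum,
        coeff_smul, smul_comm _ r])
    (fun F G G' => by
      ext1 i j
      simp only [Cend2.nthProduct, Cend2.lambdaProduct, Matrix.mul_apply, Matrix.map_apply,
        Matrix.of_apply, Matrix.add_apply, map_add, mul_add, Finset.sum_add_distrib, coeff_add,
        smul_add])
    (fun r F G => by
      ext1 i j
      simp only [Cend2.nthProduct, Cend2.lambdaProduct, Matrix.mul_apply, Matrix.map_apply,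
        Matrix.of_apply, Matrix.smul_apply, shiftLambda_smul, mul_smul_comm, ← Finset.smul_sum,
        coeff_smul, smul_comm _ r])
  parity i :=
    { carrier := {F | ∀ a b : Fin 2, (a.val + b.val : ZMod 2) ≠ i → F a b = 0}
      add_mem' := fun hF hG a b h => by simp [hF a b h, hG a b h]
      zero_mem' := fun a b h => rfl
      smul_mem' := fun r F hF a b h => by simp [hF a b h] }

/-- `v = diag(x, x - ∂/2)`. -/
noncomputable def Cend2.v : Cend2 k := !![C X, 0; 0, C X - C (C (1 / 2)) * X]

/-- `g = ½ (0, x; -1, 0)`. -/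
noncomputable def Cend2.g : Cend2 k := (1 / 2 : k) • (!![0, C X; -1, 0] : Cend2 k)

end Cend2

/-! Spanning comes from relations among the operators of left multiplication, and independence comes
from a concrete representation.

For spanning, associativity and the commutator relations show that the operators `L k n .v`, `L k n
.g` satisfy the commutation rules of the nonnegative modes of the Neveu–Schwarz algebra (`L_v_L_v`,
`L_v_L_g`, `L_g_L_g`). Together with locality on generators this yields a closed table of products
of $v$ and $g$ with four elements: $v$, $g$, $v_{(1)}g$ and $g_{(1)}g$. The decisive entry is
$g_{(1)}(v_{(1)}g)=g_{(1)}g$ (`L_one_g_vg`). In the table, $\partial(v_{(1)}g)$ and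
$\partial(g_{(1)}g)$ reduce to words of the other two families, which is why the third family
carries no power of $\partial$. Hence the span of the words is stable under $\partial$ and under
left products with generators. Associativity extends this to left products with all elements, so the
span is the whole algebra (`wordSpan_eq_top`).

For independence, the two matrices satisfy the commutator and locality relations, so they define a
homomorphism `toCend2`. There $L_0^v$ acts as multiplication by $x$ and $\partial$ as multiplication
by $\partial$. A linear combination of words therefore becomes a combination of six fixed matrices,
four with coefficients in $\Bbbk[\partial,x]$ and two, those of $v_{(1)}g$ and $g_{(1)}g$, with
coefficients in $\Bbbk[x]$. If it vanishes, elimination between entries leaves equations $\partial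
r=a(x)$, which force $r=a=0$ (`injective_toCend2_linearCombination`). So the words form a basis and
`toCend2` is injective. Its range is a $\Bbbk[\partial,x]$-submodule, so finding the image is linear
algebra over that ring.

The presentation imposes locality and commutators only on generators, and does not say that its even
and odd parts meet in zero. Injectivity supplies what is missing: general locality, directness of
the grading and the commutator formula are pulled back from `Cend2` (`isAssocConformal`,
`isEnvelope`). Universality is then formal, since any other envelope satisfies the defining
relations. -/

section Curly

/-! ### Bilinearity and sesquilinearity of the reversed product. -/

variable {k C : Type u} [Field k] [AddCommGroup C] [Module k C] [ConformalData k C]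

theorem curly_eq_sum {x y : C} {n M : ℕ} (h : ∀ m, n + M ≤ m → nprod k m x y = 0) :
    curly k n x y = ∑ s ∈ Finset.range M, ((-1 : k) ^ (n + s) / (s.factorial : k)) •
      ((del k : C →ₗ[k] C) ^ s) (nprod k (n + s) x y) := by
  refine finsum_eq_sum_of_support_subset _ fun s hs => ?_
  by_contra hs'
  refine hs ?_
  have : M ≤ s := by simpa using hs'
  simp [h (n + s) (by omega)]

/-- The weight $s$ kills the term $s=0$, where the truncated index $n+s-1$ could misbehave. In the
remaining terms $s/s!=1/(s-1)!$, and a shift of $s$ takes out one factor $-\partial$. -/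
theorem sum_shift_curly [CharZero k] (n M : ℕ) (x y : C) :
    ∑ s ∈ Finset.range (M + 1), ((-1 : k) ^ (n + s) / (s.factorial : k) * (s : k)) •
      ((del k : C →ₗ[k] C) ^ s) (nprod k (n + s - 1) x y) =
    - del k (∑ s ∈ Finset.range M, ((-1 : k) ^ (n + s) / (s.factorial : k)) •
      ((del k : C →ₗ[k] C) ^ s) (nprod k (n + s) x y)) := by
  rw [Finset.sum_range_succ', map_sum, ← Finset.sum_neg_distrib]
  simp only [Nat.cast_zero, mul_zero, zero_smul, add_zero, map_smul]
  refine Finset.sum_congr rfl fun s _ => ?_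
  rw [← neg_smul, pow_succ' (del k : C →ₗ[k] C), Module.End.mul_apply]
  congr 1
  rw [Nat.factorial_succ]
  have : ((s : k) + 1) ≠ 0 := by exact_mod_cast Nat.succ_ne_zero s
  have : (s.factorial : k) ≠ 0 := by exact_mod_cast Nat.factorial_ne_zero s
  push_cast
  field_simp
  ring

theorem smul_curly_pred {n M : ℕ} {x y : C} (h : ∀ m, n + M ≤ m + 1 → nprod k m x y = 0) :
    (n : k) • curly k (n - 1) x y = -∑ s ∈ Finset.range M,
      ((-1 : k) ^ (n + s) / (s.factorial : k) * (n : k)) •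
      ((del k : C →ₗ[k] C) ^ s) (nprod k (n + s - 1) x y) := by
  rcases n with _ | n
  · simp
  rw [curly_eq_sum (M := M) fun m hm => h m (by omega), Finset.smul_sum, ← Finset.sum_neg_distrib]
  refine Finset.sum_congr rfl fun s _ => ?_
  rw [smul_smul, ← neg_smul, show n + 1 + s - 1 = n + 1 - 1 + s by omega]
  congr 1
  rw [show n + 1 + s = (n + s) + 1 by omega, pow_succ, Nat.add_sub_cancel]
  ring

variable (hC : IsConformalSuperalgebra k C)
include hC

theorem curly_add_left (n : ℕ) (x x' y : C) :
    curly k n (x + x') y = curly k n x y + curly k n x' y := by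
  obtain ⟨M, hM⟩ := hC.locality x y
  obtain ⟨M', hM'⟩ := hC.locality x' y
  rw [curly_eq_sum (M := M + M') fun m hm => hM m (by omega),
    curly_eq_sum (M := M + M') fun m hm => hM' m (by omega),
    curly_eq_sum (M := M + M') fun m hm => by
      rw [map_add, LinearMap.add_apply, hM m (by omega), hM' m (by omega), add_zero],
    ← Finset.sum_add_distrib]
  simp only [map_add, LinearMap.add_apply, smul_add]

theorem curly_add_right (n : ℕ) (x y y' : C) :
    curly k n x (y + y') = curly k n x y + curly k n x y' := by
  obtain ⟨M, hM⟩ := hC.locality x y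
  obtain ⟨M', hM'⟩ := hC.locality x y'
  rw [curly_eq_sum (M := M + M') fun m hm => hM m (by omega),
    curly_eq_sum (M := M + M') fun m hm => hM' m (by omega),
    curly_eq_sum (M := M + M') fun m hm => by
      rw [map_add, hM m (by omega), hM' m (by omega), add_zero],
    ← Finset.sum_add_distrib]
  simp only [map_add, smul_add]

theorem curly_smul_left (n : ℕ) (r : k) (x y : C) :
    curly k n (r • x) y = r • curly k n x y := by
  obtain ⟨M, hM⟩ := hC.locality x y
  rw [curly_eq_sum (M := M) fun m hm => hM m (by omega),
    curly_eq_sum (M := M) fun m hm => by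
      rw [map_smul, LinearMap.smul_apply, hM m (by omega), smul_zero],
    Finset.smul_sum]
  simp only [map_smul, LinearMap.smul_apply, smul_comm _ r]

theorem curly_smul_right (n : ℕ) (r : k) (x y : C) :
    curly k n x (r • y) = r • curly k n x y := by
  obtain ⟨M, hM⟩ := hC.locality x y
  rw [curly_eq_sum (M := M) fun m hm => hM m (by omega),
    curly_eq_sum (M := M) fun m hm => by
      rw [map_smul, hM m (by omega), smul_zero],
    Finset.smul_sum]
  simp only [map_smul, smul_comm _ r]

/-- Sesquilinearity produces the factor $n+s$ in the $s$-th term. Its part $s$ gives $\partial$ of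
the sum by `sum_shift_curly`, and its part $n$ gives the sum for $n-1$. The rules for the two
arguments are interchanged relative to `nprod`, as the commutator requires, since it swaps its
arguments. -/
theorem curly_D_left [CharZero k] (n : ℕ) (x y : C) :
    curly k n (del k x) y = del k (curly k n x y) + (n : k) • curly k (n - 1) x y := by
  obtain ⟨M, hM⟩ := hC.locality x y
  rw [curly_eq_sum (x := x) (n := n) (M := M + 1) fun m hm => hM m (by omega),
    smul_curly_pred (M := M + 1 + 1) fun m hm => hM m (by omega),
    ← neg_eq_iff_eq_neg.2 (sum_shift_curly (k := k) n (M + 1) x y),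
    curly_eq_sum (M := M + 1 + 1) fun m hm => by
      rw [hC.D_mul, hM _ (by omega), smul_zero, neg_zero],
    ← neg_add, ← Finset.sum_add_distrib, ← Finset.sum_neg_distrib]
  refine Finset.sum_congr rfl fun s _ => ?_
  rw [hC.D_mul, map_neg, map_smul]
  push_cast
  module

/-- The same splitting of $n+s$ applies; the part $s$ now cancels against the terms where $\partial$
stands outside the product. -/
theorem curly_D_right [CharZero k] (n : ℕ) (x y : C) :
    curly k n x (del k y) = -((n : k) • curly k (n - 1) x y) := by
  obtain ⟨M, hM⟩ := hC.locality x y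
  rw [smul_curly_pred (M := M + 1 + 1) fun m hm => hM m (by omega), neg_neg,
    curly_eq_sum (M := M + 1 + 1) fun m hm => by
      rw [hC.mul_D, hM _ (by omega), hM _ (by omega), smul_zero, map_zero, add_zero]]
  have h1 := sum_shift_curly (k := k) n (M + 1) x y
  rw [← curly_eq_sum (x := x) (n := n) (M := M + 1) fun m hm => hM m (by omega),
    curly_eq_sum (x := x) (n := n) (M := M + 1 + 1) fun m hm => hM m (by omega)] at h1
  rw [← sub_eq_zero, ← Finset.sum_sub_distrib]
  rw [← sub_eq_zero, sub_neg_eq_add, map_sum, ← Finset.sum_add_distrib] at h1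
  rw [← h1]
  refine Finset.sum_congr rfl fun s _ => ?_
  rw [hC.mul_D, map_add, map_smul, map_smul, ← Module.End.mul_apply (_ ^ s), ← pow_succ, pow_succ',
    Module.End.mul_apply]
  push_cast
  module

end Curly

/-! ### Evaluation of formal monomials and the universal property of the presented algebra. -/

namespace FreeConf

variable {k L : Type u} [Field k]

theorem D_single (m : ConfMonomial L) (r : k) :
    (D (Finsupp.single m r) : FreeConf k L) = Finsupp.single (.D m) r := by
  simp [D, Finsupp.lmapDomain_apply]

theorem mul_single (n : ℕ) (m m' : ConfMonomial L) (r r' : k) :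
    (mul n (Finsupp.single m r) (Finsupp.single m' r') : FreeConf k L) =
      Finsupp.single (.mul n m m') (r * r') := by
  simp [mul, Finsupp.lmapDomain_apply]

end FreeConf

section Lift

variable {k L C : Type u} [Field k] [AddCommGroup L] [Module k L] [AddCommGroup C] [Module k C]
  [ConformalData k C]

/-- The value of a formal monomial in a conformal algebra. -/
def ConfMonomial.eval (φ : L →ₗ[k] C) : ConfMonomial L → C
  | .of a => φ a
  | .D m => del k (m.eval φ)
  | .mul n m m' => nprod k n (m.eval φ) (m'.eval φ)

namespace FreeConf

/-- The extension of a linear map to the free algebra. -/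
noncomputable def lift (φ : L →ₗ[k] C) : FreeConf k L →ₗ[k] C :=
  Finsupp.linearCombination k (ConfMonomial.eval φ)

theorem lift_single (φ : L →ₗ[k] C) (m : ConfMonomial L) (r : k) :
    lift φ (Finsupp.single m r) = r • m.eval φ :=
  Finsupp.linearCombination_single k r m

theorem lift_of (φ : L →ₗ[k] C) (a : L) : lift φ (of a) = φ a := by
  rw [of, lift_single, one_smul]; rfl

theorem lift_D (φ : L →ₗ[k] C) (a : FreeConf k L) : lift φ (D a) = del k (lift φ a) := by
  induction a using Finsupp.induction_linear with
  | zero => simp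
  | add a b ha hb => simp only [map_add, ha, hb]
  | single m r => rw [D_single, lift_single, lift_single, map_smul]; rfl

theorem lift_mul (φ : L →ₗ[k] C) (n : ℕ) (a b : FreeConf k L) :
    lift φ (mul n a b) = nprod k n (lift φ a) (lift φ b) := by
  induction a using Finsupp.induction_linear with
  | zero => simp
  | add a a' ha ha' => simp only [map_add, LinearMap.add_apply, ha, ha']
  | single m r =>
    induction b using Finsupp.induction_linear with
    | zero => simp
    | add b b' hb hb' => simp only [map_add, hb, hb']
    | single m' r' =>
      rw [mul_single, lift_single, lift_single, lift_single, map_smul, map_smul,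
        LinearMap.smul_apply, smul_smul, mul_comm]
      rfl

theorem lift_D_pow (φ : L →ₗ[k] C) (s : ℕ) (a : FreeConf k L) :
    lift φ ((D ^ s) a) = ((del k : C →ₗ[k] C) ^ s) (lift φ a) := by
  induction s with
  | zero => rfl
  | succ s ih => rw [pow_succ', Module.End.mul_apply, lift_D, ih, pow_succ', Module.End.mul_apply]

end FreeConf

variable [ConformalData k L] {I : Type} {x : I → L} {p : I → ZMod 2} {N : I → I → ℕ}

/-- The kernel of the evaluation map contains the defining relations of the envelope. -/
theorem isEnvelopeIdeal_ker_lift (hC : IsAssocConformal k C) {φ : L →ₗ[k] C}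
    (hD : ∀ a, φ (del k a) = del k (φ a))
    (hbr : ∀ i j n, φ (nprod k n (x i) (x j)) = nprod k n (φ (x i)) (φ (x j)) -
      superSign k (p i) (p j) • curly k n (φ (x j)) (φ (x i)))
    (hloc : ∀ i j n, N i j ≤ n → nprod k n (φ (x i)) (φ (x j)) = 0) :
    IsEnvelopeIdeal x p N (LinearMap.ker (FreeConf.lift φ)) := by
  refine ⟨fun r hr => ?_, fun r hr => ?_, fun n a r hr => ⟨?_, ?_⟩⟩
  · rw [LinearMap.mem_ker]
    cases hr with
    | of_add a b => simp only [map_sub, map_add, FreeConf.lift_of, sub_self]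
    | of_smul c a => simp only [map_sub, map_smul, FreeConf.lift_of, sub_self]
    | of_D a => simp only [map_sub, FreeConf.lift_D, FreeConf.lift_of, hD, sub_self]
    | D_mul n a b =>
      simp only [map_add, map_smul, FreeConf.lift_mul, FreeConf.lift_D, hC.D_mul, neg_add_cancel]
    | mul_D n a b =>
      simp only [map_sub, map_add, map_smul, FreeConf.lift_mul, FreeConf.lift_D, hC.mul_D, sub_self]
    | assoc n m a b c =>
      simp only [map_sub, map_sum, map_smul, FreeConf.lift_mul, hC.assoc n m, sub_self]
    | locality i j n h => rw [FreeConf.lift_mul, FreeConf.lift_of, FreeConf.lift_of, hloc i j n h]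
    | commutator i j n =>
      simp only [map_sub, map_sum, map_smul, FreeConf.lift_mul, FreeConf.lift_D_pow,
        FreeConf.lift_of]
      rw [hbr, curly_eq_sum (M := N j i) fun m hm => hloc j i m (by omega), sub_self]
  · rw [LinearMap.mem_ker] at hr ⊢
    rw [FreeConf.lift_D, hr, map_zero]
  · rw [LinearMap.mem_ker] at hr ⊢
    rw [FreeConf.lift_mul, hr, map_zero]
  · rw [LinearMap.mem_ker] at hr ⊢
    rw [FreeConf.lift_mul, hr, map_zero, LinearMap.zero_apply]

namespace Envelope

/-- The homomorphism of the envelope induced by an evaluation map that kills the relations. -/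
noncomputable def lift (φ : L →ₗ[k] C)
    (h : IsEnvelopeIdeal x p N (LinearMap.ker (FreeConf.lift φ))) : Envelope k x p N →ₗ[k] C :=
  (envelopeIdeal k x p N).liftQ (FreeConf.lift φ) (sInf_le h)

theorem mk_D (a : FreeConf k L) : (Submodule.Quotient.mk (FreeConf.D a) : Envelope k x p N) =
    del k (Submodule.Quotient.mk a : Envelope k x p N) := rfl

theorem mk_mul (n : ℕ) (a b : FreeConf k L) :
    (Submodule.Quotient.mk (FreeConf.mul n a b) : Envelope k x p N) =
    nprod k n (Submodule.Quotient.mk a : Envelope k x p N) (Submodule.Quotient.mk b) := rfl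

theorem mk_of (a : L) : (Submodule.Quotient.mk (FreeConf.of a) : Envelope k x p N) =
    Envelope.ι k x p N a := rfl

theorem mk_D_pow (s : ℕ) (a : FreeConf k L) :
    (Submodule.Quotient.mk ((FreeConf.D ^ s) a) : Envelope k x p N) =
    ((del k : Envelope k x p N →ₗ[k] _) ^ s) (Submodule.Quotient.mk a : Envelope k x p N) := by
  induction s with
  | zero => rfl
  | succ s ih => rw [pow_succ', Module.End.mul_apply, mk_D, ih, pow_succ', Module.End.mul_apply]

theorem mk_eq_zero {r : FreeConf k L} (hr : EnvelopeRel x p N r) :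
    (Submodule.Quotient.mk r : Envelope k x p N) = 0 :=
  (Submodule.Quotient.mk_eq_zero _).2 ((isEnvelopeIdeal_envelopeIdeal k x p N).1 r hr)

/-- A subspace that contains `ι a` for all `a` and is stable under all operations is everything. -/
theorem generates (S : Submodule k (Envelope k x p N)) (h : ∀ a, Envelope.ι k x p N a ∈ S)
    (hD : ∀ c ∈ S, del k c ∈ S)
    (hmul : ∀ n, ∀ c ∈ S, ∀ c' ∈ S, nprod k n c c' ∈ S) : S = ⊤ := by
  have hmon (m : ConfMonomial L) :
      (Submodule.Quotient.mk (Finsupp.single m 1) : Envelope k x p N) ∈ S := by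
    induction m with
    | of a => exact h a
    | D m ih => rw [← FreeConf.D_single, mk_D]; exact hD _ ih
    | mul n m m' ih ih' =>
      rw [← mul_one (1 : k), ← FreeConf.mul_single, mk_mul]; exact hmul n _ ih _ ih'
  refine eq_top_iff.2 fun c _ => ?_
  obtain ⟨a, rfl⟩ := Submodule.Quotient.mk_surjective _ c
  induction a using Finsupp.induction_linear with
  | zero => exact S.zero_mem
  | add a b ha hb => exact S.add_mem (ha trivial) (hb trivial)
  | single m r =>
    rw [← mul_one r, ← smul_eq_mul, ← Finsupp.smul_single]
    exact S.smul_mem r (hmon m)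

section

variable (φ : L →ₗ[k] C) (h : IsEnvelopeIdeal x p N (LinearMap.ker (FreeConf.lift φ)))

theorem lift_ι (a : L) : lift φ h (Envelope.ι k x p N a) = φ a := FreeConf.lift_of φ a

theorem lift_D (c : Envelope k x p N) : lift φ h (del k c) = del k (lift φ h c) := by
  obtain ⟨a, rfl⟩ := Submodule.Quotient.mk_surjective _ c
  exact FreeConf.lift_D φ a

theorem lift_mul (n : ℕ) (c c' : Envelope k x p N) :
    lift φ h (nprod k n c c') = nprod k n (lift φ h c) (lift φ h c') := by
  obtain ⟨a, rfl⟩ := Submodule.Quotient.mk_surjective _ c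
  obtain ⟨b, rfl⟩ := Submodule.Quotient.mk_surjective _ c'
  exact FreeConf.lift_mul φ n a b

theorem eval_mem_parity (hC : IsConformalSuperalgebra k C)
    (hp : ∀ i a, a ∈ parity k i → φ a ∈ parity k i) (m : ConfMonomial L) (i : ZMod 2)
    (hm : m.HasParity k i) : m.eval φ ∈ parity k i := by
  induction hm with
  | of i a ha => exact hp i a ha
  | D i m _ ih => exact hC.D_mem i _ ih
  | mul i j n m m' _ _ ih ih' => exact hC.mul_mem i j n _ _ ih ih'

/-- The induced map is a homomorphism of conformal superalgebras. -/
theorem isConformalHom_lift (hC : IsConformalSuperalgebra k C)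
    (hp : ∀ i a, a ∈ parity k i → φ a ∈ parity k i) : IsConformalHom k (lift φ h) where
  map_D := lift_D φ h
  map_mul := lift_mul φ h
  map_parity i c hc := by
    obtain ⟨a, ha, rfl⟩ := hc
    refine (Submodule.span_le (p := (parity k i : Submodule k C).comap (FreeConf.lift φ))).2 ?_ ha
    rintro _ ⟨m, hm, rfl⟩
    change FreeConf.lift φ _ ∈ (parity k i : Submodule k C)
    rw [FreeConf.lift_single, one_smul]
    exact eval_mem_parity φ hC hp m i hm

end

theorem D_mul (n : ℕ) (a b : Envelope k x p N) :
    nprod k n (del k a) b = -((n : k) • nprod k (n - 1) a b) := by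
  obtain ⟨a, rfl⟩ := Submodule.Quotient.mk_surjective _ a
  obtain ⟨b, rfl⟩ := Submodule.Quotient.mk_surjective _ b
  rw [← add_eq_zero_iff_eq_neg]
  exact mk_eq_zero (EnvelopeRel.D_mul (x := x) (p := p) (N := N) n a b)

theorem mul_D (n : ℕ) (a b : Envelope k x p N) :
    nprod k n a (del k b) = del k (nprod k n a b) + (n : k) • nprod k (n - 1) a b := by
  obtain ⟨a, rfl⟩ := Submodule.Quotient.mk_surjective _ a
  obtain ⟨b, rfl⟩ := Submodule.Quotient.mk_surjective _ b
  rw [← sub_eq_zero]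
  exact mk_eq_zero (EnvelopeRel.mul_D (x := x) (p := p) (N := N) n a b)

theorem assoc (n m : ℕ) (a b c : Envelope k x p N) :
    nprod k n a (nprod k m b c) = ∑ s ∈ Finset.range (n + 1), (n.choose s : k) •
      nprod k (n + m - s) (nprod k s a b) c := by
  obtain ⟨a, rfl⟩ := Submodule.Quotient.mk_surjective _ a
  obtain ⟨b, rfl⟩ := Submodule.Quotient.mk_surjective _ b
  obtain ⟨c, rfl⟩ := Submodule.Quotient.mk_surjective _ c
  have := mk_eq_zero (EnvelopeRel.assoc (x := x) (p := p) (N := N) n m a b c)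
  rw [← Submodule.mkQ_apply, map_sub, map_sum, sub_eq_zero] at this
  simp only [map_smul] at this
  exact this

theorem D_mem (i : ZMod 2) (c : Envelope k x p N) (hc : c ∈ parity k i) : del k c ∈ parity k i := by
  obtain ⟨a, ha, rfl⟩ := hc
  refine ⟨FreeConf.D a, (Submodule.span_le (p := Submodule.comap FreeConf.D (Submodule.span k
    {a : FreeConf k L | ∃ m : ConfMonomial L, m.HasParity k i ∧ a = Finsupp.single m 1}))).2
    ?_ ha, rfl⟩
  rintro _ ⟨m, hm, rfl⟩
  exact Submodule.subset_span ⟨.D m, .D i m hm, FreeConf.D_single m 1⟩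

theorem mul_mem (i j : ZMod 2) (n : ℕ) (c c' : Envelope k x p N) (hc : c ∈ parity k i)
    (hc' : c' ∈ parity k j) : nprod k n c c' ∈ parity k (i + j) := by
  obtain ⟨a, ha, rfl⟩ := hc
  obtain ⟨b, hb, rfl⟩ := hc'
  refine ⟨FreeConf.mul n a b, ?_, rfl⟩
  refine Submodule.span_induction₂ (p := fun a b _ _ => FreeConf.mul n a b ∈ _)
    ?_ ?_ ?_ ?_ ?_ ?_ ?_ ha hb
  · rintro _ _ ⟨m, hm, rfl⟩ ⟨m', hm', rfl⟩
    rw [FreeConf.mul_single, mul_one]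
    exact Submodule.subset_span ⟨_, .mul i j n m m' hm hm', rfl⟩
  · intro y _; simp
  · intro y _; simp
  · intro a b c _ _ _ h h'; simpa using add_mem h h'
  · intro a b c _ _ _ h h'; simpa using add_mem h h'
  · intro r a b _ _ h; simpa using Submodule.smul_mem _ r h
  · intro r a b _ _ h; simpa using Submodule.smul_mem _ r h

theorem ι_D (a : L) : Envelope.ι k x p N (del k a) = del k (Envelope.ι k x p N a) :=
  sub_eq_zero.1 (mk_eq_zero (EnvelopeRel.of_D (x := x) (p := p) (N := N) a))

theorem ι_mem (i : ZMod 2) (a : L) (ha : a ∈ parity k i) : Envelope.ι k x p N a ∈ parity k i :=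
  ⟨FreeConf.of a, Submodule.subset_span ⟨_, .of i a ha, rfl⟩, rfl⟩

theorem locality_gen (i j : I) (n : ℕ) (h : N i j ≤ n) :
    nprod k n (Envelope.ι k x p N (x i)) (Envelope.ι k x p N (x j)) = 0 :=
  mk_eq_zero (EnvelopeRel.locality (x := x) (p := p) (N := N) i j n h)

theorem ι_bracket_gen (i j : I) (n : ℕ) :
    Envelope.ι k x p N (nprod k n (x i) (x j)) =
      nprod k n (Envelope.ι k x p N (x i)) (Envelope.ι k x p N (x j)) -
      superSign k (p i) (p j) • ∑ s ∈ Finset.range (N j i),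
        ((-1 : k) ^ (n + s) / (s.factorial : k)) • ((del k : Envelope k x p N →ₗ[k] _) ^ s)
          (nprod k (n + s) (Envelope.ι k x p N (x j)) (Envelope.ι k x p N (x i))) := by
  have := mk_eq_zero (EnvelopeRel.commutator (k := k) (x := x) (p := p) (N := N) i j n)
  rw [← Submodule.mkQ_apply, map_sub, map_sub, map_smul, map_sum, sub_eq_zero] at this
  simp only [map_smul, Submodule.mkQ_apply, mk_D_pow, mk_mul, mk_of] at this
  exact this

/-- A generator-and-relations envelope is universal as soon as it is an envelope. -/
theorem isUniversalEnvelope (hp : ∀ i, x i ∈ parity k (p i))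
    (h : IsEnvelope k x N (Envelope.ι k x p N)) :
    IsUniversalEnvelope k x N (Envelope.ι k x p N) := by
  refine ⟨h, fun C _ _ _ φ hφ => ?_⟩
  have hker : IsEnvelopeIdeal x p N (LinearMap.ker (FreeConf.lift φ)) :=
    isEnvelopeIdeal_ker_lift hφ.assoc hφ.map_D
      (fun i j n => hφ.map_bracket _ _ n _ _ (hp i) (hp j)) hφ.locality
  refine ⟨lift φ hker, ⟨isConformalHom_lift φ hker hφ.assoc.toIsConformalSuperalgebra
    hφ.map_parity, LinearMap.ext (lift_ι φ hker)⟩, ?_⟩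
  rintro f ⟨hf, hfι⟩
  -- Uniqueness: the locus where two homomorphisms agree is closed under all operations and contains
  -- the image of `ι`.
  have hS := generates (LinearMap.eqLocus f (lift φ hker))
    (fun a => by
      rw [LinearMap.mem_eqLocus, lift_ι, ← hfι]; rfl)
    (fun c hc => by
      rw [LinearMap.mem_eqLocus] at hc ⊢
      rw [hf.map_D, lift_D, hc])
    (fun n c hc c' hc' => by
      rw [LinearMap.mem_eqLocus] at hc hc' ⊢
      rw [hf.map_mul, lift_mul, hc, hc'])
  exact LinearMap.ext fun c => (hS ▸ Submodule.mem_top : c ∈ LinearMap.eqLocus f (lift φ hker))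

end Envelope

end Lift

/-! ### The axioms of an associative conformal superalgebra for `Cend2`. -/

section Cend2Laws

variable {k : Type u} [Field k]

theorem bivariate_induction {P : k[X][X] → Prop} (hC : ∀ a, P (C (C a))) (hx : P (C X)) (hX : P X)
    (hadd : ∀ f g, P f → P g → P (f + g)) (hmul : ∀ f g, P f → P g → P (f * g)) (f : k[X][X]) :
    P f := by
  induction f using Polynomial.induction_on with
  | C a =>
    induction a using Polynomial.induction_on with
    | C a => exact hC a
    | add a b ha hb => rw [C_add]; exact hadd _ _ ha hb
    | monomial n a ih => rw [pow_succ, ← mul_assoc, C_mul]; exact hmul _ _ ih hx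
  | add f g hf hg => exact hadd f g hf hg
  | monomial n a ih => rw [pow_succ, ← mul_assoc]; exact hmul _ _ ih hX

/-! ### The translation `f(∂, x) ↦ f(∂ + λ, x + λ)` -/

@[simp] theorem shiftLambda_X : shiftLambda (X : k[X][X]) = C X + X := by simp [shiftLambda]

@[simp] theorem shiftLambda_C_X : shiftLambda (C X : k[X][X]) = C (C X) + X := by
  simp [shiftLambda]

@[simp] theorem shiftLambda_C_C (a : k) : shiftLambda (C (C a) : k[X][X]) = C (C (C a)) := by
  simp [shiftLambda]

@[simp] theorem evalNegLambda_X : evalNegLambda (X : k[X][X]) = -X := by simp [evalNegLambda]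

@[simp] theorem evalNegLambda_C (a : k[X]) : evalNegLambda (C a : k[X][X]) = C (C a) := by
  simp [evalNegLambda]

theorem coeff_zero_shiftLambda (f : k[X][X]) : (shiftLambda f).coeff 0 = f := by
  induction f using bivariate_induction with
  | hC a => simp
  | hx => simp
  | hX => simp
  | hadd f g hf hg => rw [map_add, coeff_add, hf, hg]
  | hmul f g hf hg => rw [map_mul, mul_coeff_zero, hf, hg]

/-- The derivation `∂/∂∂ + ∂/∂x` of `k[∂, x]`. -/
noncomputable def shiftDeriv (f : k[X][X]) : k[X][X] := (shiftLambda f).coeff 1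

/-- Differentiating $f(\partial+\lambda,x+\lambda)$ in $\lambda$ is the chain rule. It suffices to
check variables and constants, because both sides obey the Leibniz rule over the ring homomorphism
`shiftLambda`. -/
theorem derivative_shiftLambda (f : k[X][X]) :
    derivative (shiftLambda f) = shiftLambda (shiftDeriv f) := by
  induction f using bivariate_induction with
  | hC a => simp [shiftDeriv]
  | hx => simp [shiftDeriv]
  | hX => simp [shiftDeriv]
  | hadd f g hf hg =>
    rw [map_add, map_add, hf, hg, ← map_add]
    simp only [shiftDeriv, map_add, coeff_add]
  | hmul f g hf hg =>
    have : shiftDeriv (f * g) = f * shiftDeriv g + shiftDeriv f * g := by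
      rw [shiftDeriv, map_mul, mul_coeff_one, coeff_zero_shiftLambda, coeff_zero_shiftLambda]
      rfl
    rw [map_mul, derivative_mul, hf, hg, this, map_add, map_mul, map_mul, add_comm]

theorem iterate_derivative_shiftLambda (n : ℕ) (f : k[X][X]) :
    derivative^[n] (shiftLambda f) = shiftLambda (shiftDeriv^[n] f) := by
  induction n generalizing f with
  | zero => rfl
  | succ n ih =>
    rw [Function.iterate_succ_apply, Function.iterate_succ_apply, derivative_shiftLambda, ih]

/-- Taylor's formula. The factor $n!$ in the $n$-th product removes every denominator, so no
assumption on the characteristic enters. -/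
theorem factorial_smul_coeff_shiftLambda (n : ℕ) (f : k[X][X]) :
    (n.factorial : k) • (shiftLambda f).coeff n = shiftDeriv^[n] f := by
  rw [← coeff_zero_shiftLambda (shiftDeriv^[n] f), ← iterate_derivative_shiftLambda,
    coeff_iterate_derivative, zero_add, Nat.descFactorial_self, Nat.cast_smul_eq_nsmul]

theorem iterate_shiftDeriv_mul (n : ℕ) (f g : k[X][X]) :
    shiftDeriv^[n] (f * g) = ∑ s ∈ Finset.range (n + 1),
      n.choose s • (shiftDeriv^[s] f * shiftDeriv^[n - s] g) := by
  rw [← coeff_zero_shiftLambda (shiftDeriv^[n] (f * g)), ← iterate_derivative_shiftLambda, mul_comm,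
    RingHom.map_mul, iterate_derivative_mul, finsetSum_coeff]
  refine Finset.sum_congr rfl fun s _ => ?_
  rw [coeff_smul, mul_coeff_zero, iterate_derivative_shiftLambda, iterate_derivative_shiftLambda,
    coeff_zero_shiftLambda, coeff_zero_shiftLambda, mul_comm]

theorem shiftDeriv_C (a : k[X]) : ∃ b, shiftDeriv (C a) = C b := by
  induction a using Polynomial.induction_on with
  | C a => exact ⟨0, by simp [shiftDeriv]⟩
  | add a b ha hb =>
    obtain ⟨a', ha⟩ := ha
    obtain ⟨b', hb⟩ := hb
    refine ⟨a' + b', ?_⟩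
    rw [C_add (a := a'), ← ha, ← hb]
    simp only [shiftDeriv, map_add, coeff_add]
  | monomial n a ih =>
    obtain ⟨b, hb⟩ := ih
    refine ⟨C a * X ^ n + b * X, ?_⟩
    rw [C_add, C_mul (a := b), ← hb, pow_succ, ← mul_assoc, C_mul, shiftDeriv, map_mul,
      mul_coeff_one, coeff_zero_shiftLambda, coeff_zero_shiftLambda]
    simp [shiftDeriv]

theorem iterate_shiftDeriv_C (n : ℕ) (a : k[X]) : ∃ b, shiftDeriv^[n] (C a) = C b := by
  induction n with
  | zero => exact ⟨a, rfl⟩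
  | succ n ih =>
    obtain ⟨b, hb⟩ := ih
    rw [Function.iterate_succ_apply', hb]
    exact shiftDeriv_C b

/-! ### The products of matrix entries -/

/-- The `n`-th product of `Cend₁ = k[∂, x]`. -/
noncomputable def entryProduct (n : ℕ) : k[X][X] →ₗ[k] k[X][X] →ₗ[k] k[X][X] :=
  LinearMap.mk₂ k (fun f g => (n.factorial : k) • (evalNegLambda f * shiftLambda g).coeff n)
    (fun f f' g => by simp only [map_add, add_mul, coeff_add, smul_add])
    (fun r f g => by simp only [evalNegLambda_smul, smul_mul_assoc, coeff_smul, smul_comm _ r])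
    (fun f g g' => by simp only [map_add, mul_add, coeff_add, smul_add])
    (fun r f g => by simp only [shiftLambda_smul, mul_smul_comm, coeff_smul, smul_comm _ r])

theorem entryProduct_apply (n : ℕ) (f g : k[X][X]) :
    entryProduct n f g = (n.factorial : k) • (evalNegLambda f * shiftLambda g).coeff n := rfl

theorem entryProduct_X_mul (n : ℕ) (f g : k[X][X]) :
    entryProduct n (X * f) g = -((n : k) • entryProduct (n - 1) f g) := by
  have h : evalNegLambda (X * f) * shiftLambda g = -(X * (evalNegLambda f * shiftLambda g)) := by
    rw [map_mul, evalNegLambda_X]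
    ring
  rw [entryProduct_apply, h, coeff_neg, smul_neg]
  rcases n with _ | n
  · simp
  · rw [coeff_X_mul, Nat.factorial_succ, Nat.cast_mul, mul_smul]
    rfl

theorem entryProduct_mul_X (n : ℕ) (f g : k[X][X]) :
    entryProduct n f (X * g) = X * entryProduct n f g + (n : k) • entryProduct (n - 1) f g := by
  have h : evalNegLambda f * shiftLambda (X * g) =
      C X * (evalNegLambda f * shiftLambda g) + X * (evalNegLambda f * shiftLambda g) := by
    rw [map_mul, shiftLambda_X]
    ring
  rw [entryProduct_apply, h, coeff_add, coeff_C_mul,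
    smul_add, ← mul_smul_comm]
  rcases n with _ | n
  · simp [entryProduct_apply]
  · rw [coeff_X_mul, Nat.factorial_succ, Nat.cast_mul, mul_smul (_ : k) (_ : k) (coeff _ n)]
    simp only [entryProduct_apply, Nat.add_sub_cancel, Nat.factorial_succ, Nat.cast_mul]

theorem entryProduct_C (n : ℕ) (a : k[X]) (g : k[X][X]) :
    entryProduct n (C a) g = C a * shiftDeriv^[n] g := by
  rw [entryProduct_apply, evalNegLambda_C, coeff_C_mul, ← mul_smul_comm,
    factorial_smul_coeff_shiftLambda]

theorem entryProduct_locality (f g : k[X][X]) :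
    ∃ M : ℕ, ∀ n, M ≤ n → entryProduct n f g = 0 :=
  ⟨(evalNegLambda f * shiftLambda g).natDegree + 1, fun n hn => by
    rw [entryProduct_apply, coeff_eq_zero_of_natDegree_lt hn, smul_zero]⟩

/-- Both sides lower $n$ by one; the coefficients match by $(n+1)\binom ns=(s+1)\binom{n+1}{s+1}$.
-/
theorem entryProduct_assoc_X_left {f g h : k[X][X]}
    (H : ∀ n m, entryProduct n f (entryProduct m g h) = ∑ s ∈ Finset.range (n + 1),
      (n.choose s : k) • entryProduct (n + m - s) (entryProduct s f g) h) (n m : ℕ) :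
    entryProduct n (X * f) (entryProduct m g h) = ∑ s ∈ Finset.range (n + 1),
      (n.choose s : k) • entryProduct (n + m - s) (entryProduct s (X * f) g) h := by
  simp only [entryProduct_X_mul]
  rcases n with _ | n
  · simp
  · rw [Finset.sum_range_succ', Nat.add_sub_cancel, H, Finset.smul_sum, ← Finset.sum_neg_distrib]
    simp only [Nat.cast_zero, zero_smul, neg_zero, map_zero, LinearMap.zero_apply, smul_zero,
      add_zero]
    refine Finset.sum_congr rfl fun s _ => ?_
    rw [show n + 1 + m - (s + 1) = n + m - s by omega, Nat.add_sub_cancel, map_neg, map_smul,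
      LinearMap.neg_apply, LinearMap.smul_apply, smul_neg, smul_smul, smul_smul]
    congr 2
    exact_mod_cast congrArg (Nat.cast (R := k)) (Nat.add_one_mul_choose_eq n s)

/-- On the right, $\partial(f_{(s)}g)$ contributes $-(n+m-s)$ and the reindexed term $s\,f_{(s-1)}g$
contributes $n-s$. The total is $-m$, the coefficient on the left. -/
theorem entryProduct_assoc_X_right {f g h : k[X][X]}
    (H : ∀ n m, entryProduct n f (entryProduct m g h) = ∑ s ∈ Finset.range (n + 1),
      (n.choose s : k) • entryProduct (n + m - s) (entryProduct s f g) h) (n m : ℕ) :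
    entryProduct n f (entryProduct m (X * g) h) = ∑ s ∈ Finset.range (n + 1),
      (n.choose s : k) • entryProduct (n + m - s) (entryProduct s f (X * g)) h := by
  simp only [entryProduct_mul_X, map_add, LinearMap.add_apply, smul_add, Finset.sum_add_distrib,
    entryProduct_X_mul, map_neg, map_smul, LinearMap.smul_apply]
  rw [Finset.sum_range_succ' (fun s => (n.choose s : k) • (s : k) • _)]
  -- After reindexing, the second sum has one term fewer; a vanishing last term puts it back on the
  -- range of the first.
  have hlast : (n.choose (n + 1) : k) • ((n + 1 : ℕ) : k) •
      entryProduct (n + m - (n + 1)) (entryProduct (n + 1 - 1) f g) h = 0 := by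
    rw [Nat.choose_succ_self, Nat.cast_zero, zero_smul]
  rw [Nat.cast_zero, zero_smul, smul_zero, ← hlast, ← Finset.sum_range_succ (fun s =>
    (n.choose (s + 1) : k) • ((s + 1 : ℕ) : k) •
      entryProduct (n + m - (s + 1)) (entryProduct (s + 1 - 1) f g) h), ← Finset.sum_add_distrib,
    H, Finset.smul_sum, ← Finset.sum_neg_distrib]
  refine Finset.sum_congr rfl fun s hs => ?_
  have hs : s ≤ n := by simpa [Nat.lt_succ_iff] using hs
  have hc : (n.choose (s + 1) : k) * ((s + 1 : ℕ) : k) = (n.choose s : k) * ((n : k) - s) := by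
    rw [← Nat.cast_sub hs]
    exact_mod_cast congrArg (Nat.cast (R := k)) (Nat.choose_succ_right_eq n s)
  rw [smul_smul (n.choose (s + 1) : k), hc, Nat.add_sub_cancel, Nat.cast_sub (by omega),
    show n + m - (s + 1) = n + m - s - 1 by omega]
  -- For $m=0$ the total coefficient is zero, so the truncated index $m-1$ on the left does no harm.
  rcases m with _ | m
  · push_cast
    module
  · rw [show n + (m + 1 - 1) - s = n + (m + 1) - s - 1 by omega]
    push_cast
    module

/-- Sesquilinearity in the first two arguments reduces to $f=a(x)$, $g=b(x)$. There $f_{(n)}$ is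
$a\,\delta^n$ with $\delta=$ `shiftDeriv`, and the identity is the Leibniz rule for
$\delta^n(b\cdot\delta^m h)$. -/
theorem entryProduct_assoc (n m : ℕ) (f g h : k[X][X]) :
    entryProduct n f (entryProduct m g h) = ∑ s ∈ Finset.range (n + 1),
      (n.choose s : k) • entryProduct (n + m - s) (entryProduct s f g) h := by
  induction f using Polynomial.induction_on generalizing n m with
  | add f f' hf hf' =>
    simp only [map_add, LinearMap.add_apply, hf, hf', smul_add, Finset.sum_add_distrib]
  | monomial j a ih =>
    rw [pow_succ', mul_left_comm]
    exact entryProduct_assoc_X_left ih n m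
  | C a =>
    induction g using Polynomial.induction_on generalizing n m with
    | add g g' hg hg' =>
      simp only [map_add, LinearMap.add_apply, hg, hg', smul_add, Finset.sum_add_distrib]
    | monomial j b ih =>
      rw [pow_succ', mul_left_comm]
      exact entryProduct_assoc_X_right ih n m
    | C b =>
      rw [entryProduct_C, entryProduct_C, iterate_shiftDeriv_mul, Finset.mul_sum]
      refine Finset.sum_congr rfl fun s hs => ?_
      have hs : s ≤ n := by simpa [Nat.lt_succ_iff] using hs
      obtain ⟨c, hc⟩ := iterate_shiftDeriv_C s b
      rw [entryProduct_C, hc, ← C_mul, entryProduct_C, C_mul, ← Function.iterate_add_apply,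
        show n - s + m = n + m - s by omega, Nat.cast_smul_eq_nsmul, mul_smul_comm, mul_assoc]

/-! ### The associative conformal superalgebra `Cend₂` -/

namespace Cend2

theorem nprod_apply (n : ℕ) (F G : Cend2 k) (i j : Fin 2) :
    nprod k n F G i j = ∑ l, entryProduct n (F i l) (G l j) := by
  change (n.factorial : k) • (lambdaProduct F G i j).coeff n = _
  rw [lambdaProduct, Matrix.mul_apply, finsetSum_coeff, Finset.smul_sum]
  rfl

theorem del_eq (F : Cend2 k) : del k F = (X : k[X][X]) • F := by
  change Matrix.diagonal (fun _ => X) * F = _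
  ext1 i j
  simp

theorem mem_parity {i : ZMod 2} {F : Cend2 k} :
    F ∈ parity k i ↔ ∀ a b : Fin 2, (a.val + b.val : ZMod 2) ≠ i → F a b = 0 := Iff.rfl

theorem isCompl_parity : IsCompl (parity k 0 : Submodule k (Cend2 k)) (parity k 1) := by
  refine IsCompl.of_eq ((Submodule.eq_bot_iff _).2 ?_) ((Submodule.eq_top_iff').2 ?_)
  · rintro F ⟨h0, h1⟩
    ext1 a b
    by_cases h : (a.val + b.val : ZMod 2) = 0
    · exact mem_parity.1 h1 a b (by rw [h]; decide)
    · exact mem_parity.1 h0 a b h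
  · intro F
    refine Submodule.mem_sup.2 ⟨!![F 0 0, 0; 0, F 1 1], ?_, !![0, F 0 1; F 1 0, 0], ?_, ?_⟩
    · refine mem_parity.2 fun a b h => ?_
      fin_cases a <;> fin_cases b <;> first | rfl | exact absurd (by decide) h
    · refine mem_parity.2 fun a b h => ?_
      fin_cases a <;> fin_cases b <;> first | rfl | exact absurd (by decide) h
    · ext1 a b
      fin_cases a <;> fin_cases b <;> simp

variable (k) in
theorem isAssocConformal : IsAssocConformal k (Cend2 k) where
  locality F G := by
    choose M hM using fun i l j : Fin 2 => entryProduct_locality (F i l) (G l j)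
    refine ⟨∑ i, ∑ l, ∑ j, M i l j, fun n hn => ?_⟩
    ext1 i j
    rw [nprod_apply]
    refine Finset.sum_eq_zero fun l _ => hM i l j n (le_trans ?_ hn)
    calc M i l j ≤ ∑ j, M i l j :=
          Finset.single_le_sum (f := fun j => M i l j) (fun _ _ => Nat.zero_le _)
            (Finset.mem_univ j)
      _ ≤ ∑ l, ∑ j, M i l j :=
          Finset.single_le_sum (f := fun l => ∑ j, M i l j) (fun _ _ => Nat.zero_le _)
            (Finset.mem_univ l)
      _ ≤ _ := Finset.single_le_sum (f := fun i => ∑ l, ∑ j, M i l j) (fun _ _ => Nat.zero_le _)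
            (Finset.mem_univ i)
  D_mul n F G := by
    ext1 i j
    simp only [del_eq, nprod_apply, Matrix.smul_apply, Matrix.neg_apply, smul_eq_mul,
      entryProduct_X_mul, Finset.smul_sum, Finset.sum_neg_distrib]
  mul_D n F G := by
    ext1 i j
    simp only [del_eq, nprod_apply, Matrix.smul_apply, Matrix.add_apply, smul_eq_mul,
      entryProduct_mul_X, Finset.smul_sum, Finset.sum_add_distrib, Finset.mul_sum]
  isCompl := isCompl_parity
  D_mem i F hF a b h := by
    rw [del_eq, Matrix.smul_apply, mem_parity.1 hF a b h, smul_zero]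
  mul_mem i j n F G hF hG a b h := by
    rw [nprod_apply]
    refine Finset.sum_eq_zero fun l _ => ?_
    by_cases h1 : (a.val + l.val : ZMod 2) = i
    · rw [mem_parity.1 hG l b, map_zero]
      rintro rfl
      refine h ?_
      rw [← h1]
      linear_combination (-(l.val : ZMod 2)) * (CharTwo.two_eq_zero (R := ZMod 2))
    · rw [mem_parity.1 hF a l h1, map_zero, LinearMap.zero_apply]
  assoc n m F G H := by
    ext1 i j
    simp only [nprod_apply, Matrix.sum_apply, Matrix.smul_apply, map_sum, LinearMap.sum_apply,
      entryProduct_assoc n m, Finset.smul_sum]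
    rw [Finset.sum_comm' (t' := Finset.univ) (s' := fun _ => Finset.univ) (by simp)]
    rw [Finset.sum_comm (s := Finset.range (n + 1))]
    refine Finset.sum_congr rfl fun l _ => ?_
    rw [Finset.sum_comm (s := Finset.range (n + 1))]

end Cend2

end Cend2Laws

/-! ### Products in `K₁` -/

section K1Products

variable {k : Type u} [Field k]

theorem sesqui_X_mul_left (c : k[X][X]) (a b : k[X]) :
    sesqui c (X * a) b = -(X * sesqui c a b) := by
  simp only [sesqui, eval₂_mul, eval₂_X]; ring

theorem sesqui_X_mul_right (c : k[X][X]) (a b : k[X]) :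
    sesqui c a (X * b) = C X * sesqui c a b + X * sesqui c a b := by
  simp only [sesqui, eval₂_mul, eval₂_X]; ring

namespace K1

theorem del_eq (a : K1 k) : del k a = (X * a.1, X * a.2) := rfl

theorem nprod_eq (n : ℕ) (a b : K1 k) : nprod k n a b =
    (n.factorial : k) • ((lambdaBracket a b).1.coeff n, (lambdaBracket a b).2.coeff n) := rfl

theorem mem_parity_zero {a : K1 k} : a ∈ parity k 0 ↔ a.2 = 0 := Iff.rfl

theorem mem_parity_one {a : K1 k} : a ∈ parity k 1 ↔ a.1 = 0 := Iff.rfl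

theorem D_mul (n : ℕ) (a b : K1 k) :
    nprod k n (del k a) b = -((n : k) • nprod k (n - 1) a b) := by
  have h : lambdaBracket (del k a) b = -((X, X) * lambdaBracket a b) := by
    simp only [lambdaBracket, del_eq, sesqui_X_mul_left, Prod.mk_mul_mk, Prod.neg_mk]
    ext1 <;> dsimp only <;> ring
  simp only [nprod_eq, h, Prod.fst_neg, Prod.snd_neg, Prod.fst_mul, Prod.snd_mul, coeff_neg]
  rcases n with _ | n
  · simp
  · simp only [coeff_X_mul, Nat.factorial_succ, Nat.cast_mul, mul_smul, ← Prod.neg_mk, smul_neg,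
      Nat.add_sub_cancel]

theorem mul_D (n : ℕ) (a b : K1 k) :
    nprod k n a (del k b) = del k (nprod k n a b) + (n : k) • nprod k (n - 1) a b := by
  have h : lambdaBracket a (del k b) =
      (C X, C X) * lambdaBracket a b + (X, X) * lambdaBracket a b := by
    simp only [lambdaBracket, del_eq, sesqui_X_mul_right, Prod.mk_mul_mk, Prod.mk_add_mk]
    ext1 <;> dsimp only <;> ring
  rw [nprod_eq, h]
  simp only [nprod_eq, Prod.fst_add, Prod.snd_add, Prod.fst_mul, Prod.snd_mul, coeff_add,
    coeff_C_mul, del_eq, Prod.smul_fst, Prod.smul_snd, mul_smul_comm]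
  rcases n with _ | n
  · simp
  · simp only [coeff_X_mul, Nat.factorial_succ, Nat.cast_mul, mul_smul, ← Prod.mk_add_mk, smul_add,
      Nat.add_sub_cancel, ← Prod.smul_mk]

theorem lambdaBracket_v_v : lambdaBracket (gen k .v) (gen k .v) = (C X + C (C 2) * X, 0) := by
  simp [lambdaBracket, gen, sesqui]
  rfl

theorem lambdaBracket_v_g :
    lambdaBracket (gen k .v) (gen k .g) = (0, C X + C (C (3 / 2)) * X) := by
  simp [lambdaBracket, gen, sesqui]

theorem lambdaBracket_g_v : lambdaBracket (gen k .g) (gen k .v) =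
    (0, C (C (1 / 2) * X) + C (C (3 / 2)) * X) := by
  simp [lambdaBracket, gen, sesqui]

theorem lambdaBracket_g_g : lambdaBracket (gen k .g) (gen k .g) = (C (C (-1 / 2)), 0) := by
  simp [lambdaBracket, gen, sesqui]

theorem gen_v : gen k .v = (1, 0) := rfl

theorem gen_g : gen k .g = (0, 1) := rfl

theorem v_nprod_zero_v : nprod k 0 (gen k .v) (gen k .v) = del k (gen k .v) := by
  rw [nprod_eq, lambdaBracket_v_v]; simp [del_eq, gen_v]

theorem v_nprod_one_v : nprod k 1 (gen k .v) (gen k .v) = (2 : k) • gen k .v := by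
  rw [nprod_eq, lambdaBracket_v_v]; simp [gen_v, smul_eq_C_mul]

theorem v_nprod_v (n : ℕ) (hn : 2 ≤ n) : nprod k n (gen k .v) (gen k .v) = 0 := by
  obtain ⟨n, rfl⟩ := Nat.exists_eq_add_of_le' hn
  rw [nprod_eq, lambdaBracket_v_v]; simp [coeff_C_succ]

theorem v_nprod_zero_g : nprod k 0 (gen k .v) (gen k .g) = del k (gen k .g) := by
  rw [nprod_eq, lambdaBracket_v_g]; simp [del_eq, gen_g]

theorem v_nprod_one_g : nprod k 1 (gen k .v) (gen k .g) = (3 / 2 : k) • gen k .g := by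
  rw [nprod_eq, lambdaBracket_v_g]; simp [gen_g, smul_eq_C_mul]

theorem v_nprod_g (n : ℕ) (hn : 2 ≤ n) : nprod k n (gen k .v) (gen k .g) = 0 := by
  obtain ⟨n, rfl⟩ := Nat.exists_eq_add_of_le' hn
  rw [nprod_eq, lambdaBracket_v_g]; simp [coeff_C_succ]

theorem g_nprod_zero_v : nprod k 0 (gen k .g) (gen k .v) = (1 / 2 : k) • del k (gen k .g) := by
  rw [nprod_eq, lambdaBracket_g_v]; simp [del_eq, gen_g, smul_eq_C_mul]

theorem g_nprod_one_v : nprod k 1 (gen k .g) (gen k .v) = (3 / 2 : k) • gen k .g := by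
  rw [nprod_eq, lambdaBracket_g_v]; simp [gen_g, smul_eq_C_mul, coeff_C]

theorem g_nprod_v (n : ℕ) (hn : 2 ≤ n) : nprod k n (gen k .g) (gen k .v) = 0 := by
  obtain ⟨n, rfl⟩ := Nat.exists_eq_add_of_le' hn
  rw [nprod_eq, lambdaBracket_g_v]; simp [coeff_C_succ]

theorem g_nprod_zero_g : nprod k 0 (gen k .g) (gen k .g) = (-1 / 2 : k) • gen k .v := by
  rw [nprod_eq, lambdaBracket_g_g]; simp [gen_v, smul_eq_C_mul]

theorem g_nprod_g (n : ℕ) (hn : 1 ≤ n) : nprod k n (gen k .g) (gen k .g) = 0 := by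
  obtain ⟨n, rfl⟩ := Nat.exists_eq_add_of_le' hn
  rw [nprod_eq, lambdaBracket_g_g]; simp

/-- A `∂`-stable property of homogeneous elements holds as soon as it holds for the generator. -/
theorem homogeneous_induction {P : K1 k → Prop} (hadd : ∀ a b, P a → P b → P (a + b))
    (hsmul : ∀ (r : k) a, P a → P (r • a)) (hD : ∀ a, P a → P (del k a)) {i : K1Gen}
    (hi : P (gen k i)) {a : K1 k} (ha : a ∈ parity k i.parity) : P a := by
  obtain ⟨p, q⟩ := a
  cases i with
  | v =>
    obtain rfl : q = 0 := ha
    induction p using Polynomial.induction_on with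
    | C a =>
      convert hsmul a _ hi using 1
      simp [gen_v, smul_eq_C_mul]
    | add p p' hp hp' =>
      convert hadd _ _ hp hp' using 1
      simp
    | monomial n a ih =>
      convert hD _ ih using 1
      rw [del_eq, pow_succ', mul_left_comm, mul_zero]
  | g =>
    obtain rfl : p = 0 := ha
    induction q using Polynomial.induction_on with
    | C a =>
      convert hsmul a _ hi using 1
      simp [gen_g, smul_eq_C_mul]
    | add p p' hp hp' =>
      convert hadd _ _ hp hp' using 1
      simp
    | monomial n a ih =>
      convert hD _ ih using 1
      rw [del_eq, pow_succ', mul_left_comm, mul_zero]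

theorem exists_parity_eq (i : ZMod 2) : ∃ x : K1Gen, x.parity = i := by
  fin_cases i
  · exact ⟨.v, rfl⟩
  · exact ⟨.g, rfl⟩

theorem gen_mem_parity (i : K1Gen) : gen k i ∈ parity k i.parity := by
  cases i with
  | v => exact mem_parity_zero.2 rfl
  | g => exact mem_parity_one.2 rfl

theorem exists_add (a : K1 k) : ∃ b ∈ parity k 0, ∃ c ∈ parity k 1, b + c = a :=
  ⟨(a.1, 0), rfl, (0, a.2), rfl, by simp⟩

/-- A subspace that contains the generators and is stable under `∂` is everything. -/
theorem mem_of_gen_mem {S : Submodule k (K1 k)} (hD : ∀ a ∈ S, del k a ∈ S)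
    (h : ∀ i, gen k i ∈ S) (a : K1 k) : a ∈ S := by
  obtain ⟨b, hb, c, hc, rfl⟩ := exists_add a
  have H (i : K1Gen) (a : K1 k) (ha : a ∈ parity k i.parity) : a ∈ S :=
    homogeneous_induction (P := (· ∈ S)) (fun _ _ => S.add_mem) (fun r _ => S.smul_mem r) hD
      (h i) ha
  exact S.add_mem (H .v b hb) (H .g c hc)

/-! ### Extension of the commutator formula from generators to all of $K_1$. -/

section

variable {A : Type u} [AddCommGroup A] [Module k A] [ConformalData k A] (φ : K1 k →ₗ[k] A) (σ : k)

/-- `φ` maps the brackets of `a` and `b` to the commutators with sign `σ` of their images. -/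
def MapsBracket (a b : K1 k) : Prop :=
  ∀ n, φ (nprod k n a b) = nprod k n (φ a) (φ b) - σ • curly k n (φ b) (φ a)

variable {φ σ} (hA : IsConformalSuperalgebra k A)
include hA

theorem MapsBracket.add_left {a a' b : K1 k} (h : MapsBracket φ σ a b)
    (h' : MapsBracket φ σ a' b) : MapsBracket φ σ (a + a') b := fun n => by
  rw [map_add, LinearMap.add_apply, map_add, h, h', map_add, map_add, LinearMap.add_apply,
    curly_add_right hA]
  module

theorem MapsBracket.add_right {a b b' : K1 k} (h : MapsBracket φ σ a b)
    (h' : MapsBracket φ σ a b') : MapsBracket φ σ a (b + b') := fun n => by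
  rw [map_add, map_add, h, h', map_add, map_add, curly_add_left hA]
  module

theorem MapsBracket.smul_left {a b : K1 k} (r : k) (h : MapsBracket φ σ a b) :
    MapsBracket φ σ (r • a) b := fun n => by
  rw [map_smul, LinearMap.smul_apply, map_smul, h, map_smul, map_smul, LinearMap.smul_apply,
    curly_smul_right hA]
  module

theorem MapsBracket.smul_right {a b : K1 k} (r : k) (h : MapsBracket φ σ a b) :
    MapsBracket φ σ a (r • b) := fun n => by
  rw [map_smul, map_smul, h, map_smul, map_smul, curly_smul_left hA]
  module

variable [CharZero k] (hφ : ∀ a, φ (del k a) = del k (φ a))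
include hφ

/-- The bracket and both halves of the commutator are sesquilinear by the same rule, the second half
through `curly_D_right`. -/
theorem MapsBracket.D_left {a b : K1 k} (h : MapsBracket φ σ a b) :
    MapsBracket φ σ (del k a) b := fun n => by
  rw [D_mul, map_neg, map_smul, hφ, h, hA.D_mul, curly_D_right hA]
  module

theorem MapsBracket.D_right {a b : K1 k} (h : MapsBracket φ σ a b) :
    MapsBracket φ σ a (del k b) := fun n => by
  rw [mul_D, map_add, map_smul, hφ, hφ, h, h, hA.mul_D, curly_D_left hA, map_sub, map_smul]
  module

/-- The commutator formula for the images of the generators extends to all of `K₁`. -/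
theorem map_bracket_of_gen
    (h : ∀ i j : K1Gen, MapsBracket φ (superSign k i.parity j.parity) (gen k i) (gen k j))
    (i j : ZMod 2) (n : ℕ) (a b : K1 k) (ha : a ∈ parity k i) (hb : b ∈ parity k j) :
    φ (nprod k n a b) = nprod k n (φ a) (φ b) - superSign k i j • curly k n (φ b) (φ a) := by
  obtain ⟨i, rfl⟩ := exists_parity_eq i
  obtain ⟨j, rfl⟩ := exists_parity_eq j
  have hb : MapsBracket φ (superSign k i.parity j.parity) (gen k i) b :=
    homogeneous_induction (P := MapsBracket φ _ (gen k i)) (fun _ _ => MapsBracket.add_right hA)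
      (fun r _ => MapsBracket.smul_right hA r) (fun _ => MapsBracket.D_right hA hφ) (h i j) hb
  exact homogeneous_induction (P := fun a => MapsBracket φ _ a b)
    (fun _ _ => MapsBracket.add_left hA) (fun r _ => MapsBracket.smul_left hA r)
    (fun _ => MapsBracket.D_left hA hφ) hb ha n

end

end K1

end K1Products

/-! ### The representation of `K₁` by `Cend₂` -/

section ShiftDeriv

variable {k : Type u} [Field k]

theorem shiftDeriv_smul (r : k) (f : k[X][X]) : shiftDeriv (r • f) = r • shiftDeriv f := by
  rw [shiftDeriv, shiftLambda_smul, coeff_smul]; rfl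

theorem shiftDeriv_sub (f g : k[X][X]) : shiftDeriv (f - g) = shiftDeriv f - shiftDeriv g := by
  rw [shiftDeriv, map_sub, coeff_sub]; rfl

theorem shiftDeriv_zero : shiftDeriv (0 : k[X][X]) = 0 := by
  rw [shiftDeriv, map_zero, coeff_zero]

theorem shiftDeriv_one : shiftDeriv (1 : k[X][X]) = 0 := by
  rw [shiftDeriv, map_one, coeff_one, if_neg one_ne_zero]

theorem shiftDeriv_X : shiftDeriv (X : k[X][X]) = 1 := by
  rw [shiftDeriv, shiftLambda_X]; simp

theorem shiftDeriv_C_X : shiftDeriv (C X : k[X][X]) = 1 := by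
  rw [shiftDeriv, shiftLambda_C_X]; simp

theorem iterate_shiftDeriv_zero (n : ℕ) : shiftDeriv^[n] (0 : k[X][X]) = 0 :=
  Function.iterate_fixed shiftDeriv_zero n

end ShiftDeriv

namespace Cend2

section Table

variable {k : Type u} [Field k]

theorem ext_rows {F G : Cend2 k} (h₀ : ∀ j, F 0 j = G 0 j) (h₁ : ∀ j, F 1 j = G 1 j) : F = G := by
  ext1 i j
  fin_cases i
  · exact h₀ j
  · exact h₁ j

theorem v_eq : v k = !![C X, 0; 0, C X - (1 / 2 : k) • X] := by
  rw [v, smul_eq_C_C_mul]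

theorem g_eq : g k = !![0, (1 / 2 : k) • C X; (-1 / 2 : k) • 1, 0] := by
  rw [g]
  ext1 i j
  fin_cases i <;> fin_cases j <;> simp [neg_div]

theorem entryProduct_one (n : ℕ) (g : k[X][X]) : entryProduct n 1 g = shiftDeriv^[n] g := by
  rw [← C_1, entryProduct_C, C_1, one_mul]

theorem v_nprod_apply_zero (n : ℕ) (F : Cend2 k) (j : Fin 2) :
    nprod k n (v k) F 0 j = C X * shiftDeriv^[n] (F 0 j) := by
  rw [nprod_apply, Fin.sum_univ_two, v_eq]
  simp [entryProduct_C]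

/-- The lower diagonal entry is $x-\frac12\partial$. Its part $-\frac12\partial$ acts as
$-\frac12\cdot(-n)\,\delta^{n-1}$, which explains the extra term. -/
theorem v_nprod_apply_one (n : ℕ) (F : Cend2 k) (j : Fin 2) :
    nprod k n (v k) F 1 j =
      C X * shiftDeriv^[n] (F 1 j) + (n / 2 : k) • shiftDeriv^[n - 1] (F 1 j) := by
  rw [nprod_apply, Fin.sum_univ_two, v_eq]
  simp only [Matrix.of_apply, Matrix.cons_val', Matrix.cons_val_one, Matrix.cons_val_zero,
    Matrix.cons_val_fin_one, map_zero, LinearMap.zero_apply, zero_add, map_sub, map_smul,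
    LinearMap.sub_apply, LinearMap.smul_apply, entryProduct_C]
  rw [← mul_one (X : k[X][X]), entryProduct_X_mul, entryProduct_one]
  module

theorem g_nprod_apply_zero (n : ℕ) (F : Cend2 k) (j : Fin 2) :
    nprod k n (g k) F 0 j = (1 / 2 : k) • (C X * shiftDeriv^[n] (F 1 j)) := by
  rw [nprod_apply, Fin.sum_univ_two, g_eq]
  simp [entryProduct_C, -smul_C]

theorem g_nprod_apply_one (n : ℕ) (F : Cend2 k) (j : Fin 2) :
    nprod k n (g k) F 1 j = (-1 / 2 : k) • shiftDeriv^[n] (F 0 j) := by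
  rw [nprod_apply, Fin.sum_univ_two, g_eq]
  simp [entryProduct_one]

theorem v_apply : v k 0 0 = C X ∧ v k 0 1 = 0 ∧ v k 1 0 = 0 ∧ v k 1 1 = C X - (1 / 2 : k) • X := by
  rw [v_eq]; exact ⟨rfl, rfl, rfl, rfl⟩

theorem g_apply : g k 0 0 = 0 ∧ g k 0 1 = (1 / 2 : k) • C X ∧ g k 1 0 = (-1 / 2 : k) • 1 ∧
    g k 1 1 = 0 := by
  rw [g_eq]; exact ⟨rfl, rfl, rfl, rfl⟩

theorem iterate_shiftDeriv_v (n : ℕ) (i j : Fin 2) : shiftDeriv^[n + 2] (v k i j) = 0 := by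
  rw [Function.iterate_add_apply, show shiftDeriv^[2] (v k i j) = 0 from ?_,
    iterate_shiftDeriv_zero]
  rw [Function.iterate_succ_apply, Function.iterate_one]
  obtain ⟨h₀₀, h₀₁, h₁₀, h₁₁⟩ := v_apply (k := k)
  fin_cases i <;> fin_cases j <;>
  simp only [Fin.zero_eta, Fin.mk_one, h₀₀, h₀₁, h₁₀, h₁₁, shiftDeriv_zero, shiftDeriv_one,
    shiftDeriv_X, shiftDeriv_C_X, shiftDeriv_sub, shiftDeriv_smul, smul_zero, sub_zero]

theorem iterate_shiftDeriv_g (n : ℕ) (i j : Fin 2) : shiftDeriv^[n + 2] (g k i j) = 0 := by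
  rw [Function.iterate_add_apply, show shiftDeriv^[2] (g k i j) = 0 from ?_,
    iterate_shiftDeriv_zero]
  rw [Function.iterate_succ_apply, Function.iterate_one]
  obtain ⟨h₀₀, h₀₁, h₁₀, h₁₁⟩ := g_apply (k := k)
  fin_cases i <;> fin_cases j <;>
  simp only [Fin.zero_eta, Fin.mk_one, h₀₀, h₀₁, h₁₀, h₁₁, shiftDeriv_zero, shiftDeriv_one,
    shiftDeriv_C_X, shiftDeriv_smul, smul_zero]

/-- The entries have degree at most one, so $\delta^2$ kills them. The second row also involves
$\delta^{n-1}$, hence the bound 3 instead of 2. -/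
theorem v_nprod_v_eq_zero (n : ℕ) (hn : 3 ≤ n) : nprod k n (v k) (v k) = 0 := by
  obtain ⟨n, rfl⟩ := Nat.exists_eq_add_of_le' hn
  refine ext_rows (fun j => ?_) fun j => ?_
  · rw [v_nprod_apply_zero, iterate_shiftDeriv_v, mul_zero]
    rfl
  · rw [v_nprod_apply_one, iterate_shiftDeriv_v, show n + 3 - 1 = n + 2 by rfl,
      iterate_shiftDeriv_v, mul_zero, smul_zero, add_zero]
    rfl

theorem g_nprod_v_eq_zero (n : ℕ) (hn : 2 ≤ n) : nprod k n (g k) (v k) = 0 := by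
  obtain ⟨n, rfl⟩ := Nat.exists_eq_add_of_le' hn
  refine ext_rows (fun j => ?_) fun j => ?_
  · rw [g_nprod_apply_zero, iterate_shiftDeriv_v, mul_zero, smul_zero]
    rfl
  · rw [g_nprod_apply_one, iterate_shiftDeriv_v, smul_zero]
    rfl

theorem g_nprod_g_eq_zero (n : ℕ) (hn : 2 ≤ n) : nprod k n (g k) (g k) = 0 := by
  obtain ⟨n, rfl⟩ := Nat.exists_eq_add_of_le' hn
  refine ext_rows (fun j => ?_) fun j => ?_
  · rw [g_nprod_apply_zero, iterate_shiftDeriv_g, mul_zero, smul_zero]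
    rfl
  · rw [g_nprod_apply_one, iterate_shiftDeriv_g, smul_zero]
    rfl

theorem v_nprod_g_eq_zero (n : ℕ) (hn : 2 ≤ n) : nprod k n (v k) (g k) = 0 := by
  obtain ⟨n, rfl⟩ := Nat.exists_eq_add_of_le' hn
  refine ext_rows (fun j => ?_) fun j => ?_
  · rw [v_nprod_apply_zero, iterate_shiftDeriv_g, mul_zero]
    rfl
  · rw [v_nprod_apply_one, iterate_shiftDeriv_g, mul_zero, zero_add]
    -- At the boundary value 2 a single $\delta$ remains, and it suffices because the second row of
    -- $g$ is constant.
    rcases n with _ | n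
    · obtain ⟨-, -, h₁₀, h₁₁⟩ := g_apply (k := k)
      fin_cases j <;>
      simp only [Fin.zero_eta, Fin.mk_one, h₁₀, h₁₁, Function.iterate_one, zero_add,
        Nat.add_one_sub_one, shiftDeriv_smul, shiftDeriv_one, shiftDeriv_zero, smul_zero] <;> rfl
    · rw [show n + 1 + 2 - 1 = n + 2 by rfl, iterate_shiftDeriv_g, smul_zero]
      rfl

/-- This makes $L_0^v$ multiplication by $x$ in the image, so words become monomials times fixed
matrices. -/
theorem v_nprod_zero (F : Cend2 k) : nprod k 0 (v k) F = (C X : k[X][X]) • F := by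
  refine ext_rows (fun j => ?_) fun j => ?_
  · rw [v_nprod_apply_zero, Function.iterate_zero_apply, Matrix.smul_apply, smul_eq_mul]
  · rw [v_nprod_apply_one, Function.iterate_zero_apply, Matrix.smul_apply, smul_eq_mul,
      Nat.cast_zero, zero_div, zero_smul, add_zero]

theorem eq_of_entries {F : Cend2 k} {a b c d : k[X][X]} (h₀₀ : F 0 0 = a) (h₀₁ : F 0 1 = b)
    (h₁₀ : F 1 0 = c) (h₁₁ : F 1 1 = d) : F = !![a, b; c, d] := by
  subst h₀₀ h₀₁ h₁₀ h₁₁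
  exact Matrix.eta_fin_two F

theorem g_nprod_zero_v : nprod k 0 (g k) (v k) =
    !![0, (1 / 2 : k) • (C X * (C X - (1 / 2 : k) • X)); (-1 / 2 : k) • C X, 0] := by
  obtain ⟨h₀₀, h₀₁, h₁₀, h₁₁⟩ := v_apply (k := k)
  refine eq_of_entries ?_ ?_ ?_ ?_
  · rw [g_nprod_apply_zero, h₁₀, Function.iterate_zero_apply, mul_zero, smul_zero]
  · rw [g_nprod_apply_zero, h₁₁, Function.iterate_zero_apply]
  · rw [g_nprod_apply_one, h₀₀, Function.iterate_zero_apply]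
  · rw [g_nprod_apply_one, h₀₁, Function.iterate_zero_apply, smul_zero]

theorem g_nprod_one_v : nprod k 1 (g k) (v k) =
    !![0, (1 / 2 : k) • (C X * (1 - (1 / 2 : k) • 1)); (-1 / 2 : k) • 1, 0] := by
  obtain ⟨h₀₀, h₀₁, h₁₀, h₁₁⟩ := v_apply (k := k)
  refine eq_of_entries ?_ ?_ ?_ ?_
  · rw [g_nprod_apply_zero, h₁₀, Function.iterate_one, shiftDeriv_zero, mul_zero, smul_zero]
  · rw [g_nprod_apply_zero, h₁₁, Function.iterate_one, shiftDeriv_sub, shiftDeriv_smul,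
      shiftDeriv_X, shiftDeriv_C_X]
  · rw [g_nprod_apply_one, h₀₀, Function.iterate_one, shiftDeriv_C_X]
  · rw [g_nprod_apply_one, h₀₁, Function.iterate_one, shiftDeriv_zero, smul_zero]

theorem g_nprod_zero_g : nprod k 0 (g k) (g k) =
    !![(1 / 2 : k) • (C X * (-1 / 2 : k) • 1), 0; 0, (-1 / 2 : k) • (1 / 2 : k) • C X] := by
  obtain ⟨h₀₀, h₀₁, h₁₀, h₁₁⟩ := g_apply (k := k)
  refine eq_of_entries ?_ ?_ ?_ ?_
  · rw [g_nprod_apply_zero, h₁₀, Function.iterate_zero_apply]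
  · rw [g_nprod_apply_zero, h₁₁, Function.iterate_zero_apply, mul_zero, smul_zero]
  · rw [g_nprod_apply_one, h₀₀, Function.iterate_zero_apply, smul_zero]
  · rw [g_nprod_apply_one, h₀₁, Function.iterate_zero_apply]

theorem g_nprod_one_g :
    nprod k 1 (g k) (g k) = !![0, 0; 0, (-1 / 2 : k) • (1 / 2 : k) • 1] := by
  obtain ⟨h₀₀, h₀₁, h₁₀, h₁₁⟩ := g_apply (k := k)
  refine eq_of_entries ?_ ?_ ?_ ?_
  · rw [g_nprod_apply_zero, h₁₀, Function.iterate_one, shiftDeriv_smul, shiftDeriv_one, smul_zero,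
      mul_zero, smul_zero]
  · rw [g_nprod_apply_zero, h₁₁, Function.iterate_one, shiftDeriv_zero, mul_zero, smul_zero]
  · rw [g_nprod_apply_one, h₀₀, Function.iterate_one, shiftDeriv_zero, smul_zero]
  · rw [g_nprod_apply_one, h₀₁, Function.iterate_one, shiftDeriv_smul, shiftDeriv_C_X]

theorem v_nprod_one_v : nprod k 1 (v k) (v k) = !![C X, 0; 0,
    C X * (1 - (1 / 2 : k) • 1) + (1 / 2 : k) • (C X - (1 / 2 : k) • X)] := by
  obtain ⟨h₀₀, h₀₁, h₁₀, h₁₁⟩ := v_apply (k := k)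
  refine eq_of_entries ?_ ?_ ?_ ?_
  · rw [v_nprod_apply_zero, h₀₀, Function.iterate_one, shiftDeriv_C_X, mul_one]
  · rw [v_nprod_apply_zero, h₀₁, Function.iterate_one, shiftDeriv_zero, mul_zero]
  · rw [v_nprod_apply_one, h₁₀, Function.iterate_one, shiftDeriv_zero, mul_zero, Nat.sub_self,
      Function.iterate_zero_apply, smul_zero, add_zero]
  · rw [v_nprod_apply_one, h₁₁, Function.iterate_one, shiftDeriv_sub, shiftDeriv_smul,
      shiftDeriv_X, shiftDeriv_C_X, Nat.sub_self, Function.iterate_zero_apply, Nat.cast_one]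

theorem v_nprod_two_v : nprod k 2 (v k) (v k) =
    !![0, 0; 0, (2 / 2 : k) • (1 - (1 / 2 : k) • 1)] := by
  obtain ⟨h₀₀, h₀₁, h₁₀, h₁₁⟩ := v_apply (k := k)
  refine eq_of_entries ?_ ?_ ?_ ?_
  · rw [v_nprod_apply_zero, iterate_shiftDeriv_v 0, mul_zero]
  · rw [v_nprod_apply_zero, iterate_shiftDeriv_v 0, mul_zero]
  · rw [v_nprod_apply_one, iterate_shiftDeriv_v 0, mul_zero, h₁₀, Nat.add_one_sub_one,
      Function.iterate_one, shiftDeriv_zero, smul_zero, add_zero]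
  · rw [v_nprod_apply_one, iterate_shiftDeriv_v 0, mul_zero, h₁₁, Nat.add_one_sub_one,
      Function.iterate_one, shiftDeriv_sub, shiftDeriv_smul,
      shiftDeriv_X, shiftDeriv_C_X, Nat.cast_ofNat, zero_add]

theorem v_nprod_one_g : nprod k 1 (v k) (g k) = !![0, C X * (1 / 2 : k) • 1;
    (1 / 2 : k) • (-1 / 2 : k) • 1, 0] := by
  obtain ⟨h₀₀, h₀₁, h₁₀, h₁₁⟩ := g_apply (k := k)
  refine eq_of_entries ?_ ?_ ?_ ?_
  · rw [v_nprod_apply_zero, h₀₀, Function.iterate_one, shiftDeriv_zero, mul_zero]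
  · rw [v_nprod_apply_zero, h₀₁, Function.iterate_one, shiftDeriv_smul, shiftDeriv_C_X]
  · rw [v_nprod_apply_one, h₁₀, Function.iterate_one, shiftDeriv_smul, shiftDeriv_one, smul_zero,
      mul_zero, Nat.sub_self, Function.iterate_zero_apply, zero_add, Nat.cast_one]
  · rw [v_nprod_apply_one, h₁₁, Function.iterate_one, shiftDeriv_zero, mul_zero, Nat.sub_self,
      Function.iterate_zero_apply, smul_zero, add_zero]

end Table

end Cend2

/-- Three is the largest of the four locality bounds, so this one truncation serves every pair of
generators. -/
theorem curly_eq_of_locality_three {k C : Type u} [Field k] [AddCommGroup C] [Module k C]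
    [ConformalData k C] {x y : C} (h : ∀ m, 3 ≤ m → nprod k m x y = 0) (n : ℕ) :
    curly k n x y = (-1 : k) ^ n • (nprod k n x y - del k (nprod k (n + 1) x y) +
      (1 / 2 : k) • del k (del k (nprod k (n + 2) x y))) := by
  rw [curly_eq_sum (M := 3) fun m hm => h m (by omega)]
  simp only [Finset.sum_range_succ, Finset.sum_range_zero, zero_add, pow_zero, pow_one,
    Nat.factorial, Module.End.one_apply, Nat.cast_one, add_zero, pow_add,
    Nat.cast_mul]
  rw [show (del k : C →ₗ[k] C) ^ 2 = del k * del k from pow_two _, Module.End.mul_apply]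
  module

namespace Cend2

section Representation

variable (k : Type u) [Field k]

/-- The representation `v ↦ diag(x, x - ∂/2)`, `g ↦ ½ (0, x; -1, 0)` of `K₁`. -/
noncomputable def rep : K1 k →ₗ[k] Cend2 k where
  toFun a := (a.1.map C : k[X][X]) • v k + (a.2.map C : k[X][X]) • g k
  map_add' a b := by
    rw [Prod.fst_add, Prod.snd_add, Polynomial.map_add, Polynomial.map_add]
    module
  map_smul' r a := by
    have h (p : k[X]) : ((r • p).map C : k[X][X]) = r • p.map C := by
      rw [Polynomial.map_smul, smul_eq_C_C_mul, smul_eq_C_mul]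
    rw [Prod.smul_fst, Prod.smul_snd, h, h, RingHom.id_apply, smul_add, smul_assoc, smul_assoc]

variable {k}

theorem rep_apply (a : K1 k) :
    rep k a = (a.1.map C : k[X][X]) • v k + (a.2.map C : k[X][X]) • g k := rfl

theorem rep_gen_v : rep k (K1.gen k .v) = v k := by
  rw [rep_apply, K1.gen_v, Polynomial.map_one, Polynomial.map_zero, one_smul, zero_smul, add_zero]

theorem rep_gen_g : rep k (K1.gen k .g) = g k := by
  rw [rep_apply, K1.gen_g, Polynomial.map_one, Polynomial.map_zero, one_smul, zero_smul, zero_add]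

theorem rep_D (a : K1 k) : rep k (del k a) = del k (rep k a) := by
  rw [rep_apply, rep_apply, del_eq, K1.del_eq, Polynomial.map_mul, Polynomial.map_mul,
    Polynomial.map_X]
  module

theorem v_mem_parity : v k ∈ parity k 0 := by
  obtain ⟨-, h₀₁, h₁₀, -⟩ := v_apply (k := k)
  refine mem_parity.2 fun a b h => ?_
  fin_cases a <;> fin_cases b
  · exact absurd (by decide) h
  · exact h₀₁
  · exact h₁₀
  · exact absurd (by decide) h

theorem g_mem_parity : g k ∈ parity k 1 := by
  obtain ⟨h₀₀, -, -, h₁₁⟩ := g_apply (k := k)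
  refine mem_parity.2 fun a b h => ?_
  fin_cases a <;> fin_cases b
  · exact h₀₀
  · exact absurd (by decide) h
  · exact absurd (by decide) h
  · exact h₁₁

theorem rep_gen_mem_parity (i : K1Gen) : rep k (K1.gen k i) ∈ parity k i.parity := by
  cases i with
  | v => rw [rep_gen_v]; exact v_mem_parity
  | g => rw [rep_gen_g]; exact g_mem_parity

theorem rep_mem_parity (i : ZMod 2) (a : K1 k) (ha : a ∈ parity k i) : rep k a ∈ parity k i := by
  obtain ⟨i, rfl⟩ := K1.exists_parity_eq i
  refine K1.homogeneous_induction (P := fun a => rep k a ∈ parity k i.parity) (fun a b ha hb => ?_)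
    (fun r a ha => ?_) (fun a ha => ?_) (rep_gen_mem_parity i) ha
  · rw [map_add]; exact Submodule.add_mem _ ha hb
  · rw [map_smul]; exact Submodule.smul_mem _ r ha
  · rw [rep_D]; exact (isAssocConformal k).D_mem _ _ ha

theorem rep_locality (i j : K1Gen) (n : ℕ) (h : K1Gen.N i j ≤ n) :
    nprod k n (rep k (K1.gen k i)) (rep k (K1.gen k j)) = 0 := by
  cases i <;> cases j <;> simp only [rep_gen_v, rep_gen_g]
  · exact v_nprod_v_eq_zero n h
  · exact v_nprod_g_eq_zero n h
  · exact g_nprod_v_eq_zero n h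
  · exact g_nprod_g_eq_zero n h

variable [CharZero k]

theorem rep_mapsBracket_v_v : K1.MapsBracket (rep k) 1 (K1.gen k .v) (K1.gen k .v) := by
  intro n
  rw [rep_gen_v, curly_eq_of_locality_three v_nprod_v_eq_zero]
  rcases n with _ | _ | _ | n
  · rw [K1.v_nprod_zero_v, rep_D, rep_gen_v, zero_add, zero_add, v_nprod_one_v, v_nprod_two_v]
    simp only [del_eq, v_eq]
    ext1 i j
    fin_cases i <;> fin_cases j <;>
    simp only [Matrix.smul_apply, Matrix.add_apply, Matrix.sub_apply, smul_eq_mul, Fin.zero_eta,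
      Fin.mk_one, Matrix.of_apply, Matrix.cons_val', Matrix.cons_val_zero, Matrix.cons_val_one,
      Matrix.cons_val_fin_one] <;> algebra with k
  · rw [zero_add, K1.v_nprod_one_v, map_smul, rep_gen_v, v_nprod_one_v, v_nprod_two_v,
      v_nprod_v_eq_zero 3 le_rfl]
    simp only [del_eq, v_eq]
    ext1 i j
    fin_cases i <;> fin_cases j <;>
    simp only [Matrix.smul_apply, Matrix.add_apply, Matrix.sub_apply, smul_eq_mul, Fin.zero_eta,
      Fin.mk_one, Matrix.of_apply, Matrix.cons_val', Matrix.cons_val_zero, Matrix.cons_val_one,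
      Matrix.cons_val_fin_one, Matrix.zero_apply] <;> algebra with k
  -- Locality does not annihilate $v_{(2)}v$; the two halves of the commutator cancel because
  -- $(-1)^2=1$.
  · rw [K1.v_nprod_v _ (by omega), v_nprod_v_eq_zero (0 + 1 + 1 + 1) (by omega),
      v_nprod_v_eq_zero (0 + 1 + 1 + 2) (by omega)]
    simp only [map_zero]
    module
  · rw [K1.v_nprod_v _ (by omega), v_nprod_v_eq_zero _ (by omega),
      v_nprod_v_eq_zero (_ + 1) (by omega), v_nprod_v_eq_zero (_ + 2) (by omega)]
    simp only [map_zero]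
    module

theorem rep_mapsBracket_v_g : K1.MapsBracket (rep k) 1 (K1.gen k .v) (K1.gen k .g) := by
  intro n
  rw [rep_gen_v, rep_gen_g, curly_eq_of_locality_three fun m hm => g_nprod_v_eq_zero m (by omega)]
  rcases n with _ | _ | n
  · rw [K1.v_nprod_zero_g, rep_D, rep_gen_g, zero_add, zero_add, v_nprod_zero, g_nprod_zero_v,
      g_nprod_one_v, g_nprod_v_eq_zero 2 le_rfl]
    simp only [del_eq, g_eq]
    ext1 i j
    fin_cases i <;> fin_cases j <;>
    simp only [Matrix.smul_apply, Matrix.add_apply, Matrix.sub_apply, smul_eq_mul, Fin.zero_eta,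
      Fin.mk_one, Matrix.of_apply, Matrix.cons_val', Matrix.cons_val_zero, Matrix.cons_val_one,
      Matrix.cons_val_fin_one, Matrix.zero_apply] <;> algebra with k
  · rw [zero_add, K1.v_nprod_one_g, map_smul, rep_gen_g, v_nprod_one_g, g_nprod_one_v,
      g_nprod_v_eq_zero _ (by omega), g_nprod_v_eq_zero _ (by omega)]
    simp only [del_eq, g_eq]
    ext1 i j
    fin_cases i <;> fin_cases j <;>
    simp only [Matrix.smul_apply, Matrix.add_apply, Matrix.sub_apply, smul_eq_mul, Fin.zero_eta,
      Fin.mk_one, Matrix.of_apply, Matrix.cons_val', Matrix.cons_val_zero, Matrix.cons_val_one,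
      Matrix.cons_val_fin_one, Matrix.zero_apply] <;> algebra with k
  · rw [K1.v_nprod_g _ (by omega), v_nprod_g_eq_zero _ (by omega), g_nprod_v_eq_zero _ (by omega),
      g_nprod_v_eq_zero _ (by omega), g_nprod_v_eq_zero _ (by omega)]
    simp only [map_zero]
    module

theorem rep_mapsBracket_g_v : K1.MapsBracket (rep k) 1 (K1.gen k .g) (K1.gen k .v) := by
  intro n
  rw [rep_gen_v, rep_gen_g, curly_eq_of_locality_three fun m hm => v_nprod_g_eq_zero m (by omega)]
  rcases n with _ | _ | n
  · rw [K1.g_nprod_zero_v, map_smul, rep_D, rep_gen_g, zero_add, zero_add, v_nprod_zero,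
      g_nprod_zero_v, v_nprod_one_g, v_nprod_g_eq_zero 2 le_rfl]
    simp only [del_eq, g_eq]
    ext1 i j
    fin_cases i <;> fin_cases j <;>
    simp only [Matrix.smul_apply, Matrix.add_apply, Matrix.sub_apply, smul_eq_mul, Fin.zero_eta,
      Fin.mk_one, Matrix.of_apply, Matrix.cons_val', Matrix.cons_val_zero, Matrix.cons_val_one,
      Matrix.cons_val_fin_one, Matrix.zero_apply] <;> algebra with k
  · rw [zero_add, K1.g_nprod_one_v, map_smul, rep_gen_g, v_nprod_one_g, g_nprod_one_v,
      v_nprod_g_eq_zero _ (by omega), v_nprod_g_eq_zero _ (by omega)]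
    simp only [del_eq, g_eq]
    ext1 i j
    fin_cases i <;> fin_cases j <;>
    simp only [Matrix.smul_apply, Matrix.add_apply, Matrix.sub_apply, smul_eq_mul, Fin.zero_eta,
      Fin.mk_one, Matrix.of_apply, Matrix.cons_val', Matrix.cons_val_zero, Matrix.cons_val_one,
      Matrix.cons_val_fin_one, Matrix.zero_apply] <;> algebra with k
  · rw [K1.g_nprod_v _ (by omega), g_nprod_v_eq_zero _ (by omega), v_nprod_g_eq_zero _ (by omega),
      v_nprod_g_eq_zero _ (by omega), v_nprod_g_eq_zero _ (by omega)]
    simp only [map_zero]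
    module

theorem rep_mapsBracket_g_g : K1.MapsBracket (rep k) (-1) (K1.gen k .g) (K1.gen k .g) := by
  intro n
  rw [rep_gen_g, curly_eq_of_locality_three fun m hm => g_nprod_g_eq_zero m (by omega)]
  rcases n with _ | _ | n
  · rw [K1.g_nprod_zero_g, map_smul, rep_gen_v, zero_add, zero_add,
      g_nprod_zero_g, g_nprod_one_g, g_nprod_g_eq_zero 2 le_rfl]
    simp only [del_eq, v_eq]
    ext1 i j
    fin_cases i <;> fin_cases j <;>
    simp only [Matrix.smul_apply, Matrix.add_apply, Matrix.sub_apply, smul_eq_mul, Fin.zero_eta,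
      Fin.mk_one, Matrix.of_apply, Matrix.cons_val', Matrix.cons_val_zero, Matrix.cons_val_one,
      Matrix.cons_val_fin_one, Matrix.zero_apply] <;> algebra with k
  -- Here $g_{(1)}g$ survives too: the sign of two odd elements and $(-1)^1$ compensate, and the two
  -- halves cancel.
  · rw [K1.g_nprod_g _ (by omega), g_nprod_g_eq_zero (0 + 1 + 1) (by omega),
      g_nprod_g_eq_zero (0 + 1 + 2) (by omega)]
    simp only [map_zero]
    module
  · rw [K1.g_nprod_g _ (by omega), g_nprod_g_eq_zero _ (by omega),
      g_nprod_g_eq_zero (_ + 1) (by omega), g_nprod_g_eq_zero (_ + 2) (by omega)]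
    simp only [map_zero]
    module

theorem rep_mapsBracket (i j : K1Gen) :
    K1.MapsBracket (rep k) (superSign k i.parity j.parity) (K1.gen k i) (K1.gen k j) := by
  cases i <;> cases j
  · exact rep_mapsBracket_v_v
  · exact rep_mapsBracket_v_g
  · exact rep_mapsBracket_g_v
  · exact rep_mapsBracket_g_g

theorem rep_bracket (i j : ZMod 2) (n : ℕ) (a b : K1 k) (ha : a ∈ parity k i)
    (hb : b ∈ parity k j) : rep k (nprod k n a b) =
      nprod k n (rep k a) (rep k b) - superSign k i j • curly k n (rep k b) (rep k a) :=
  K1.map_bracket_of_gen (isAssocConformal k).toIsConformalSuperalgebra rep_D rep_mapsBracket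
    i j n a b ha hb

end Representation

end Cend2

/-! ### The induced homomorphism to `Cend2`. -/

namespace K1Envelope

variable (k : Type u) [Field k] [CharZero k]

/-- The homomorphism `U(K₁; {v, g}, N) → Cend₂` induced by the representation of `K₁`. -/
noncomputable def toCend2 : K1Envelope k →ₗ[k] Cend2 k :=
  Envelope.lift (Cend2.rep k) (isEnvelopeIdeal_ker_lift (Cend2.isAssocConformal k) Cend2.rep_D
    (fun i j n => Cend2.rep_mapsBracket i j n) Cend2.rep_locality)

theorem isConformalHom_toCend2 : IsConformalHom k (toCend2 k) :=
  Envelope.isConformalHom_lift _ _ (Cend2.isAssocConformal k).toIsConformalSuperalgebra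
    Cend2.rep_mem_parity

theorem toCend2_ι (a : K1 k) : toCend2 k (K1Envelope.ι k a) = Cend2.rep k a :=
  Envelope.lift_ι _ _ a

theorem toCend2_gen_v : toCend2 k (gen k .v) = Cend2.v k :=
  (toCend2_ι k _).trans Cend2.rep_gen_v

theorem toCend2_gen_g : toCend2 k (gen k .g) = Cend2.g k :=
  (toCend2_ι k _).trans Cend2.rep_gen_g

end K1Envelope

/-! ### Relations in the envelope of `K₁` -/

namespace K1Envelope

section Relations

variable {k : Type u} [Field k]

/-- With only three nonzero products of $a$ and $b$, the associativity sum has fixed length and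
polynomial coefficients in $n$, so commutators can be compared for all $n$, $m$ at once. -/
theorem assoc_of_locality_three [CharZero k] {a b : K1Envelope k} (h : ∀ s, 3 ≤ s → nprod k s a b = 0)
    (n m : ℕ) (c : K1Envelope k) : nprod k n a (nprod k m b c) =
      nprod k (n + m) (nprod k 0 a b) c + (n : k) • nprod k (n + m - 1) (nprod k 1 a b) c +
        (n * (n - 1) / 2 : k) • nprod k (n + m - 2) (nprod k 2 a b) c := by
  rw [Envelope.assoc]
  have h1 := Finset.sum_subset (s₁ := Finset.range (n + 1)) (s₂ := Finset.range (n + 4))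
    (f := fun s => (n.choose s : k) • nprod k (n + m - s) (nprod k s a b) c)
    (Finset.range_subset_range.2 (by omega)) fun s _ hs => by
      rw [Nat.choose_eq_zero_of_lt (by simpa using hs), Nat.cast_zero, zero_smul]
  have h2 := Finset.sum_subset (s₁ := Finset.range 3) (s₂ := Finset.range (n + 4))
    (f := fun s => (n.choose s : k) • nprod k (n + m - s) (nprod k s a b) c)
    (Finset.range_subset_range.2 (by omega)) fun s _ hs => by
      rw [h s (by simpa using hs), map_zero, LinearMap.zero_apply, smul_zero]
  rw [h1, ← h2]
  simp only [Finset.sum_range_succ, Finset.sum_range_zero, zero_add, Nat.choose_zero_right,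
    Nat.choose_one_right, Nat.cast_choose_two, Nat.cast_one, one_smul, Nat.sub_zero]

/-- The operators of left multiplication form a representation of the commutator algebra. -/
theorem nprod_nprod_comm [CharZero k] {a b r₀ r₁ : K1Envelope k} {σ : k}
    (ha : ∀ s, 3 ≤ s → nprod k s a b = 0) (hb : ∀ s, 3 ≤ s → nprod k s b a = 0)
    (h₀ : nprod k 0 a b = r₀ + σ • (nprod k 0 b a - del k (nprod k 1 b a) +
      (1 / 2 : k) • del k (del k (nprod k 2 b a))))
    (h₁ : nprod k 1 a b = r₁ + σ • (-nprod k 1 b a + del k (nprod k 2 b a)))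
    (h₂ : nprod k 2 a b = σ • nprod k 2 b a) (n m : ℕ) (c : K1Envelope k) :
    nprod k n a (nprod k m b c) = σ • nprod k m b (nprod k n a c) + nprod k (n + m) r₀ c +
      (n : k) • nprod k (n + m - 1) r₁ c := by
  rw [assoc_of_locality_three ha, assoc_of_locality_three hb, h₀, h₁, h₂, add_comm m n]
  simp only [map_add, map_sub, map_neg, map_smul, LinearMap.add_apply, LinearMap.sub_apply,
    LinearMap.neg_apply, LinearMap.smul_apply, Envelope.D_mul]
  rw [show n + m - 1 - 1 = n + m - 2 by omega]
  -- The cast of $n+m-1$ is the honest difference only for $n+m>0$; at $n=m=0$ all correction terms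
  -- have coefficient zero.
  obtain h | h := Nat.eq_zero_or_pos (n + m)
  · obtain ⟨rfl, rfl⟩ : n = 0 ∧ m = 0 := by omega
    push_cast
    module
  · rw [Nat.cast_sub h]
    push_cast
    module

theorem N_le_three (i j : K1Gen) : K1Gen.N i j ≤ 3 := by
  cases i <;> cases j <;> decide

theorem L_gen_eq_zero (i j : K1Gen) (n : ℕ) (h : K1Gen.N i j ≤ n) : L k n i (gen k j) = 0 :=
  Envelope.locality_gen (x := K1.gen k) i j n h

theorem L_D (n : ℕ) (i : K1Gen) (c : K1Envelope k) :
    L k n i (del k c) = del k (L k n i c) + (n : k) • L k (n - 1) i c :=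
  Envelope.mul_D n _ c

theorem L_zero_D (i : K1Gen) (c : K1Envelope k) : L k 0 i (del k c) = del k (L k 0 i c) := by
  rw [L_D, Nat.cast_zero, zero_smul, add_zero]

theorem ι_nprod (i j : K1Gen) (n : ℕ) : K1Envelope.ι k (nprod k n (K1.gen k i) (K1.gen k j)) =
    L k n i (gen k j) - superSign k i.parity j.parity • (-1 : k) ^ n • (L k n j (gen k i) -
      del k (L k (n + 1) j (gen k i)) + (1 / 2 : k) • del k (del k (L k (n + 2) j (gen k i)))) := by
  refine (Envelope.ι_bracket_gen i j n).trans ?_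
  rw [← curly_eq_sum fun m hm => Envelope.locality_gen j i m (by omega),
    curly_eq_of_locality_three fun m hm =>
      Envelope.locality_gen j i m ((N_le_three j i).trans hm)]
  rfl

theorem superSign_zero_left (j : ZMod 2) : superSign k 0 j = 1 := by simp [superSign]

theorem superSign_one_one : superSign k 1 1 = -1 := by simp [superSign]

theorem ι_v : K1Envelope.ι k (K1.gen k .v) = gen k .v := rfl

theorem ι_g : K1Envelope.ι k (K1.gen k .g) = gen k .g := rfl

theorem v_zero_v [CharZero k] : del k (gen k .v) = L k 0 .v (gen k .v) - (L k 0 .v (gen k .v) -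
    del k (L k 1 .v (gen k .v)) + (1 / 2 : k) • del k (del k (L k 2 .v (gen k .v)))) := by
  have := ι_nprod (k := k) .v .v 0
  rw [K1.v_nprod_zero_v, Envelope.ι_D, ι_v] at this
  rw [this, show superSign k K1Gen.v.parity K1Gen.v.parity = 1 from superSign_zero_left _]
  module

theorem v_one_v : (2 : k) • gen k .v =
    (2 : k) • L k 1 .v (gen k .v) - del k (L k 2 .v (gen k .v)) := by
  have := ι_nprod (k := k) .v .v 1
  rw [K1.v_nprod_one_v, map_smul, ι_v, L_gen_eq_zero _ _ (1 + 2) le_rfl, map_zero, map_zero] at this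
  rw [this, show superSign k K1Gen.v.parity K1Gen.v.parity = 1 from superSign_zero_left _]
  module

theorem v_zero_g : del k (gen k .g) =
    L k 0 .v (gen k .g) - (L k 0 .g (gen k .v) - del k (L k 1 .g (gen k .v))) := by
  have := ι_nprod (k := k) .v .g 0
  rw [K1.v_nprod_zero_g, Envelope.ι_D, ι_g, L_gen_eq_zero _ _ (0 + 2) le_rfl, map_zero,
    map_zero] at this
  rw [this, show superSign k K1Gen.v.parity K1Gen.g.parity = 1 from superSign_zero_left _]
  module

theorem v_one_g : (3 / 2 : k) • gen k .g = L k 1 .v (gen k .g) + L k 1 .g (gen k .v) := by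
  have := ι_nprod (k := k) .v .g 1
  rw [K1.v_nprod_one_g, map_smul, ι_g, L_gen_eq_zero _ _ (1 + 1) le_rfl,
    L_gen_eq_zero .g .v (1 + 2) (by decide), map_zero, map_zero] at this
  rw [this, show superSign k K1Gen.v.parity K1Gen.g.parity = 1 from superSign_zero_left _]
  module

theorem g_zero_g : (-1 / 2 : k) • gen k .v =
    (2 : k) • L k 0 .g (gen k .g) - del k (L k 1 .g (gen k .g)) := by
  have := ι_nprod (k := k) .g .g 0
  rw [K1.g_nprod_zero_g, map_smul, ι_v, L_gen_eq_zero .g .g (0 + 2) le_rfl, map_zero,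
    map_zero] at this
  rw [this, show superSign k K1Gen.g.parity K1Gen.g.parity = -1 from superSign_one_one]
  module

theorem L_v_g (n : ℕ) (hn : 2 ≤ n) : L k n .v (gen k .g) = 0 := L_gen_eq_zero .v .g n hn

theorem L_g_v (n : ℕ) (hn : 2 ≤ n) : L k n .g (gen k .v) = 0 := L_gen_eq_zero .g .v n hn

theorem L_g_g (n : ℕ) (hn : 2 ≤ n) : L k n .g (gen k .g) = 0 := L_gen_eq_zero .g .g n hn

theorem L_v_v (n : ℕ) (hn : 3 ≤ n) : L k n .v (gen k .v) = 0 := L_gen_eq_zero .v .v n hn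

variable (k) in
/-- The element `g (1) g`. -/
noncomputable def gg : K1Envelope k := L k 1 .g (gen k .g)

variable (k) in
/-- The element `v (1) g`. -/
noncomputable def vg : K1Envelope k := L k 1 .v (gen k .g)

theorem L_one_g_v : L k 1 .g (gen k .v) = (3 / 2 : k) • gen k .g - vg k := by
  rw [v_one_g, vg]
  module

variable [CharZero k]

/-- This and the next two lemmas are the Neveu–Schwarz relations for the nonnegative modes. When the
index $n+m-1$ is truncated, $n=m=0$ and its coefficient vanishes. -/
theorem L_v_L_v (n m : ℕ) (c : K1Envelope k) : L k n .v (L k m .v c) =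
    L k m .v (L k n .v c) + (n - m : k) • L k (n + m - 1) .v c := by
  have := nprod_nprod_comm (k := k) (a := gen k .v) (b := gen k .v) (r₀ := del k (gen k .v))
    (r₁ := (2 : k) • gen k .v) (σ := 1) (fun s hs => L_gen_eq_zero .v .v s hs)
    (fun s hs => L_gen_eq_zero .v .v s hs)
    (by rw [one_smul]; exact (sub_eq_iff_eq_add.1 v_zero_v.symm))
    (by rw [v_one_v]; simp only [L]; module) (by rw [one_smul]) n m c
  refine this.trans ?_
  rw [Envelope.D_mul, map_smul, LinearMap.smul_apply]
  simp only [L]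
  push_cast
  module

theorem L_v_L_g (n m : ℕ) (c : K1Envelope k) : L k n .v (L k m .g c) =
    L k m .g (L k n .v c) + (n / 2 - m : k) • L k (n + m - 1) .g c := by
  have h2 : L k 2 .g (gen k .v) = 0 := L_gen_eq_zero .g .v 2 le_rfl
  have h2' : L k 2 .v (gen k .g) = 0 := L_gen_eq_zero .v .g 2 le_rfl
  have := nprod_nprod_comm (k := k) (a := gen k .v) (b := gen k .g) (r₀ := del k (gen k .g))
    (r₁ := (3 / 2 : k) • gen k .g) (σ := 1)
    (fun s hs => L_gen_eq_zero .v .g s (le_trans (by decide) hs))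
    (fun s hs => L_gen_eq_zero .g .v s (le_trans (by decide) hs))
    (by
      rw [one_smul, show nprod k 2 (gen k .g) (gen k .v) = 0 from h2, map_zero, map_zero, smul_zero,
        add_zero]
      exact (sub_eq_iff_eq_add.1 v_zero_g.symm))
    (by
      rw [show nprod k 2 (gen k .g) (gen k .v) = 0 from h2, map_zero, v_one_g]
      simp only [L]
      module)
    (by rw [one_smul]; exact h2'.trans h2.symm) n m c
  refine this.trans ?_
  rw [Envelope.D_mul, map_smul, LinearMap.smul_apply]
  simp only [L]
  push_cast
  module

theorem L_g_L_g (n m : ℕ) (c : K1Envelope k) : L k n .g (L k m .g c) =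
    -L k m .g (L k n .g c) - (1 / 2 : k) • L k (n + m) .v c := by
  have h2 : L k 2 .g (gen k .g) = 0 := L_gen_eq_zero .g .g 2 le_rfl
  have := nprod_nprod_comm (k := k) (a := gen k .g) (b := gen k .g) (r₀ := (-1 / 2 : k) • gen k .v)
    (r₁ := 0) (σ := -1)
    (fun s hs => L_gen_eq_zero .g .g s (le_trans (by decide) hs))
    (fun s hs => L_gen_eq_zero .g .g s (le_trans (by decide) hs))
    (by
      rw [show nprod k 2 (gen k .g) (gen k .g) = 0 from h2, map_zero, map_zero, g_zero_g]
      simp only [L]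
      module)
    (by
      rw [show nprod k 2 (gen k .g) (gen k .g) = 0 from h2, map_zero]
      module)
    (by rw [show nprod k 2 (gen k .g) (gen k .g) = 0 from h2, smul_zero]) n m c
  refine this.trans ?_
  rw [map_smul, LinearMap.smul_apply, map_zero, LinearMap.zero_apply]
  simp only [L]
  module

theorem D_gg : del k (gg k) = (2 : k) • L k 0 .g (gen k .g) + (1 / 2 : k) • gen k .v := by
  have := g_zero_g (k := k)
  rw [gg]
  linear_combination (norm := module) this

/-- Thus $g$ alone generates the algebra, and products with $v$ on the right can be computed from
those with $g_{(1)}g$ and $g_{(0)}g$. -/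
theorem v_eq : gen k .v = (2 : k) • del k (gg k) - (4 : k) • L k 0 .g (gen k .g) := by
  rw [D_gg]
  module

theorem D_vg : del k (vg k) =
    L k 0 .v (gen k .g) - L k 0 .g (gen k .v) + (1 / 2 : k) • del k (gen k .g) := by
  have := v_zero_g (k := k)
  rw [L_one_g_v, map_sub, map_smul] at this
  linear_combination (norm := module) this

/-- Put $A=(g_{(0)}v)_{(2)}g$ and $B=(g_{(1)}v)_{(1)}g$. Associativity gives $g_{(0)}(v_{(2)}g)=A$,
$g_{(1)}(v_{(1)}g)=A+B$ and $g_{(2)}(v_{(0)}g)=A+2B$. The first is zero by locality, and commuting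
$L_0^v$ with $L_2^g$ on $g$ shows that the last is $2\,g_{(1)}g$. Hence $A=0$ and $B=g_{(1)}g$. -/
theorem L_one_g_vg : L k 1 .g (vg k) = gg k := by
  have h3 (s : ℕ) (hs : 3 ≤ s) : nprod k s (gen k .g) (gen k .v) = 0 := L_g_v s (by omega)
  have h2 := assoc_of_locality_three h3 2 0 (gen k .g)
  have h1 := assoc_of_locality_three h3 1 1 (gen k .g)
  have h0 := assoc_of_locality_three h3 0 2 (gen k .g)
  rw [show nprod k 2 (gen k .v) (gen k .g) = 0 from L_v_g 2 le_rfl, map_zero] at h0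
  rw [show nprod k 2 (gen k .g) (gen k .v) = 0 from L_g_v 2 le_rfl, map_zero, LinearMap.zero_apply]
    at h0 h1 h2
  have hc := L_v_L_g 0 2 (gen k .g)
  rw [L_g_g 2 le_rfl, map_zero] at hc
  replace h2 : L k 2 .g (L k 0 .v (gen k .g)) =
    nprod k 2 (nprod k 0 (gen k .g) (gen k .v)) (gen k .g) +
      ((2 : ℕ) : k) • nprod k 1 (nprod k 1 (gen k .g) (gen k .v)) (gen k .g) + _ • 0 := h2
  replace h1 : L k 1 .g (vg k) = nprod k 2 (nprod k 0 (gen k .g) (gen k .v)) (gen k .g) +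
      ((1 : ℕ) : k) • nprod k 1 (nprod k 1 (gen k .g) (gen k .v)) (gen k .g) + _ • 0 := h1
  replace h0 : 0 = nprod k 2 (nprod k 0 (gen k .g) (gen k .v)) (gen k .g) +
      ((0 : ℕ) : k) • nprod k 1 (nprod k 1 (gen k .g) (gen k .v)) (gen k .g) + _ • 0 := h0
  replace hc : 0 = L k 2 .g (L k 0 .v (gen k .g)) + (((0 : ℕ) : k) / 2 - ((2 : ℕ) : k)) • gg k := hc
  rw [h2] at hc
  rw [h1]
  push_cast at *
  linear_combination (norm := module) -(1 / 2 : k) • h0 - (1 / 2 : k) • hc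

theorem L_v_gg (n : ℕ) (hn : 2 ≤ n) : L k n .v (gg k) = 0 := by
  rw [gg, L_v_L_g, L_v_g n hn, map_zero, Nat.add_sub_cancel, L_g_g n hn, smul_zero, add_zero]

theorem L_one_v_gg : L k 1 .v (gg k) = (1 / 2 : k) • gg k := by
  have := L_one_g_vg (k := k)
  rw [vg] at this
  rw [gg, L_v_L_g, this, gg]
  push_cast
  module

theorem L_two_v_v : L k 2 .v (gen k .v) = (-2 : k) • gg k := by
  rw [v_eq, map_sub, map_smul, map_smul, L_D, L_v_gg 2 le_rfl, map_zero, L_v_L_g, L_v_g 2 le_rfl,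
    map_zero]
  change (2 : k) • (0 + ((2 : ℕ) : k) • L k 1 .v (gg k)) -
    (4 : k) • (0 + (((2 : ℕ) : k) / 2 - ((0 : ℕ) : k)) • gg k) = _
  rw [L_one_v_gg]
  push_cast
  module

theorem L_one_v_v : L k 1 .v (gen k .v) = gen k .v - del k (gg k) := by
  have := v_one_v (k := k)
  rw [L_two_v_v, map_smul] at this
  linear_combination (norm := module) -(1 / 2 : k) • this

/-- For $n=1$ the anticommutation rule gives $2L_1^gL_1^gg=-\frac12L_2^vg=0$; for larger $n$ every
term on the right vanishes by locality. -/
theorem L_g_gg (n : ℕ) (hn : 1 ≤ n) : L k n .g (gg k) = 0 := by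
  have h := L_g_L_g n 1 (gen k .g)
  rw [L_v_g (n + 1) (by omega)] at h
  obtain rfl | hn := hn.eq_or_lt
  · rw [gg]
    linear_combination (norm := module) (1 / 2 : k) • h
  · rw [L_g_g n hn, map_zero] at h
    rw [gg, h]
    module

/-- Two evaluations of $g_{(1)}v$ are compared: $\frac32g-v_{(1)}g$ from the commutator, and
$6\,g_{(0)}(g_{(1)}g)+2\,v_{(1)}g$ from `v_eq`. -/
theorem L_zero_g_gg : L k 0 .g (gg k) = (1 / 4 : k) • gen k .g - (1 / 2 : k) • vg k := by
  have h := L_one_g_v (k := k)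
  have h' := L_g_L_g 1 0 (gen k .g)
  rw [v_eq, map_sub, map_smul, map_smul, L_D, L_g_gg 1 le_rfl, map_zero, h'] at h
  change (2 : k) • (0 + ((1 : ℕ) : k) • L k 0 .g (gg k)) -
    (4 : k) • (-L k 0 .g (gg k) - (1 / 2 : k) • vg k) = _ at h
  push_cast at h
  linear_combination (norm := module) (1 / 6 : k) • h

theorem vg_eq : vg k = (1 / 2 : k) • gen k .g - (2 : k) • L k 0 .g (gg k) := by
  rw [L_zero_g_gg]
  module

theorem L_one_v_vg : L k 1 .v (vg k) = (1 / 2 : k) • vg k - (2 : k) • L k 0 .g (gg k) := by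
  rw [vg_eq, map_sub, map_smul, map_smul, L_v_L_g, L_one_v_gg, map_smul]
  change (1 / 2 : k) • vg k - (2 : k) • ((1 / 2 : k) • L k 0 .g (gg k) +
    (((1 : ℕ) : k) / 2 - ((0 : ℕ) : k)) • L k 0 .g (gg k)) = _
  rw [vg_eq]
  push_cast
  module

theorem L_v_vg (n : ℕ) (hn : 2 ≤ n) : L k n .v (vg k) = 0 := by
  rw [vg, L_v_L_v, L_v_g n hn, map_zero, Nat.add_sub_cancel, L_v_g n hn, smul_zero, add_zero]

/-- Expressing $v_{(1)}g$ by `vg_eq` leaves the square of $L_0^g$, which is $-\frac14L_0^v$. -/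
theorem L_zero_g_vg :
    L k 0 .g (vg k) = (1 / 2 : k) • L k 0 .g (gen k .g) + (1 / 2 : k) • L k 0 .v (gg k) := by
  have h := L_g_L_g 0 0 (gg k)
  rw [vg_eq, map_sub, map_smul, map_smul]
  linear_combination (norm := module) -h

theorem L_g_vg (n : ℕ) (hn : 2 ≤ n) : L k n .g (vg k) = 0 := by
  have h := L_v_L_g 1 n (gen k .g)
  rw [L_g_g n hn, map_zero, Nat.add_sub_cancel_left, L_g_g n hn, smul_zero, add_zero] at h
  exact h.symm

end Relations

/-! ### The words span the envelope. -/

section Spanning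

variable (k : Type u) [Field k]

/-- The span of the words. -/
noncomputable def wordSpan : Submodule k (K1Envelope k) :=
  Submodule.span k (Set.range (K1Word.eval k))

variable {k}

theorem eval_mem (w : K1Word) : w.eval k ∈ wordSpan k := Submodule.subset_span ⟨w, rfl⟩

theorem L_zero_v_mem {c : K1Envelope k} (hc : c ∈ wordSpan k) : L k 0 .v c ∈ wordSpan k := by
  refine (Submodule.span_le (p := (wordSpan k).comap (L k 0 .v))).2 ?_ hc
  rintro _ ⟨w, rfl⟩
  change L k 0 .v (w.eval k) ∈ wordSpan k
  cases w with
  | plain n s x =>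
    convert eval_mem (.plain (n + 1) s x) using 1
    rw [K1Word.eval, K1Word.eval, pow_succ', Module.End.mul_apply]
  | withL0g n s x =>
    convert eval_mem (.withL0g (n + 1) s x) using 1
    rw [K1Word.eval, K1Word.eval, pow_succ', Module.End.mul_apply]
  | withL1 n x =>
    convert eval_mem (.withL1 (n + 1) x) using 1
    rw [K1Word.eval, K1Word.eval, pow_succ', Module.End.mul_apply]

theorem L_zero_v_pow_mem {S : Submodule k (K1Envelope k)} (hS : ∀ c ∈ S, L k 0 .v c ∈ S) (n : ℕ)
    {c : K1Envelope k} (hc : c ∈ S) : (L k 0 .v ^ n) c ∈ S := by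
  induction n with
  | zero => exact hc
  | succ n ih => rw [pow_succ', Module.End.mul_apply]; exact hS _ ih

theorem L_zero_v_pow_D (n : ℕ) (c : K1Envelope k) :
    del k ((L k 0 .v ^ n) c) = (L k 0 .v ^ n) (del k c) := by
  induction n with
  | zero => rfl
  | succ n ih => rw [pow_succ', Module.End.mul_apply, Module.End.mul_apply, ← L_zero_D, ih]

theorem L_zero_D_pow (i : K1Gen) (s : ℕ) (c : K1Envelope k) :
    L k 0 i (((del k : K1Envelope k →ₗ[k] K1Envelope k) ^ s) c) =
      ((del k : K1Envelope k →ₗ[k] K1Envelope k) ^ s) (L k 0 i c) := by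
  induction s with
  | zero => rfl
  | succ s ih => rw [pow_succ', Module.End.mul_apply, L_zero_D, ih, Module.End.mul_apply]

theorem gen_mem (i : K1Gen) : gen k i ∈ wordSpan k := eval_mem (.plain 0 0 i)

theorem D_gen_mem (i : K1Gen) : del k (gen k i) ∈ wordSpan k := eval_mem (.plain 0 1 i)

theorem L_zero_g_gen_mem (i : K1Gen) : L k 0 .g (gen k i) ∈ wordSpan k := eval_mem (.withL0g 0 0 i)

theorem gg_mem : gg k ∈ wordSpan k := eval_mem (.withL1 0 .g)

theorem vg_mem : vg k ∈ wordSpan k := eval_mem (.withL1 0 .v)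

variable (k) in
/-- The elements whose products with the generators lie in the span of the words. -/
noncomputable def stablePart : Submodule k (K1Envelope k) :=
  ⨅ n, ⨅ i, (wordSpan k).comap (L k n i)

theorem mem_stablePart {c : K1Envelope k} :
    c ∈ stablePart k ↔ ∀ n i, L k n i c ∈ wordSpan k := by
  simp [stablePart, Submodule.mem_iInf]

variable (k) in
/-- The elements that map the span of the words to itself by all left products. -/
noncomputable def leftStabilizer : Submodule k (K1Envelope k) where
  carrier := {a | ∀ n, ∀ c ∈ wordSpan k, nprod k n a c ∈ wordSpan k}
  zero_mem' := fun n c _ => by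
    rw [map_zero, LinearMap.zero_apply]
    exact zero_mem _
  add_mem' := fun ha hb n c hc => by
    rw [map_add, LinearMap.add_apply]
    exact add_mem (ha n c hc) (hb n c hc)
  smul_mem' := fun r a ha n c hc => by
    rw [map_smul, LinearMap.smul_apply]
    exact Submodule.smul_mem _ r (ha n c hc)

theorem D_mem_leftStabilizer {a : K1Envelope k} (ha : a ∈ leftStabilizer k) :
    del k a ∈ leftStabilizer k := fun n c hc => by
  rw [Envelope.D_mul]
  exact neg_mem (Submodule.smul_mem _ _ (ha (n - 1) c hc))

/-- In the associativity formula for $a_{(n)}(b_{(m)}c)$ the term $(a_{(n)}b)_{(m)}c$ has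
coefficient one, so it is determined by products with $a$ and $b$ and by the $a_{(s)}b$ with $s<n$.
-/
theorem nprod_mem_leftStabilizer {a b : K1Envelope k} (ha : a ∈ leftStabilizer k)
    (hb : b ∈ leftStabilizer k) (n : ℕ) : nprod k n a b ∈ leftStabilizer k := by
  induction n using Nat.strong_induction_on with
  | _ n ih =>
    intro m c hc
    have h := Envelope.assoc n m a b c
    rw [Finset.sum_range_succ, Nat.choose_self, Nat.cast_one, one_smul, Nat.add_sub_cancel_left,
      ← sub_eq_iff_eq_add'] at h
    rw [← h]
    exact sub_mem (ha n _ (hb m c hc)) (sum_mem fun s hs =>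
      Submodule.smul_mem _ _ (ih s (Finset.mem_range.1 hs) _ c hc))

theorem ι_mem_of_gen_mem {S : Submodule k (K1Envelope k)} (hD : ∀ c ∈ S, del k c ∈ S)
    (h : ∀ i, gen k i ∈ S) (a : K1 k) : K1Envelope.ι k a ∈ S :=
  K1.mem_of_gen_mem (S := S.comap (K1Envelope.ι k))
    (fun b hb => by
      rw [Submodule.mem_comap, Envelope.ι_D]
      exact hD _ hb) h a

variable [CharZero k]

theorem D_gg_mem : del k (gg k) ∈ wordSpan k := by
  rw [D_gg]
  exact add_mem (Submodule.smul_mem _ _ (L_zero_g_gen_mem _)) (Submodule.smul_mem _ _ (gen_mem _))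

theorem D_vg_mem : del k (vg k) ∈ wordSpan k := by
  rw [D_vg]
  exact add_mem (sub_mem (L_zero_v_mem (gen_mem _)) (L_zero_g_gen_mem _))
    (Submodule.smul_mem _ _ (D_gen_mem _))

theorem D_mem {c : K1Envelope k} (hc : c ∈ wordSpan k) : del k c ∈ wordSpan k := by
  refine (Submodule.span_le (p := (wordSpan k).comap (del k))).2 ?_ hc
  rintro _ ⟨w, rfl⟩
  change del k (w.eval k) ∈ wordSpan k
  cases w with
  | plain n s x =>
    convert eval_mem (.plain n (s + 1) x) using 1
    rw [K1Word.eval, K1Word.eval, L_zero_v_pow_D, pow_succ' (del k), Module.End.mul_apply]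
  | withL0g n s x =>
    convert eval_mem (.withL0g n (s + 1) x) using 1
    rw [K1Word.eval, K1Word.eval, L_zero_v_pow_D, ← L_zero_D, pow_succ' (del k),
      Module.End.mul_apply]
  | withL1 n x =>
    rw [K1Word.eval, L_zero_v_pow_D]
    refine L_zero_v_pow_mem (fun _ => L_zero_v_mem) n ?_
    cases x with
    | v => exact D_vg_mem
    | g => exact D_gg_mem

theorem D_mem_stablePart {c : K1Envelope k} (hc : c ∈ stablePart k) : del k c ∈ stablePart k := by
  rw [mem_stablePart] at hc ⊢
  intro n i
  rw [L_D]
  exact add_mem (D_mem (hc n i)) (Submodule.smul_mem _ _ (hc (n - 1) i))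

theorem D_pow_mem_stablePart {c : K1Envelope k} (hc : c ∈ stablePart k) (s : ℕ) :
    ((del k : K1Envelope k →ₗ[k] K1Envelope k) ^ s) c ∈ stablePart k := by
  induction s with
  | zero => exact hc
  | succ s ih => rw [pow_succ', Module.End.mul_apply]; exact D_mem_stablePart ih

/-- Commuting past $L_0^v$ leaves only a multiple of $L_{n-1}^x c$, which is already under control.
-/
theorem L_zero_v_mem_stablePart {c : K1Envelope k} (hc : c ∈ stablePart k) :
    L k 0 .v c ∈ stablePart k := by
  rw [mem_stablePart] at hc ⊢
  intro n i
  cases i with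
  | v =>
    rw [L_v_L_v]
    exact add_mem (L_zero_v_mem (hc n .v)) (Submodule.smul_mem _ _ (hc _ .v))
  | g =>
    have h := L_v_L_g 0 n c
    rw [← sub_eq_iff_eq_add] at h
    rw [← h]
    exact sub_mem (L_zero_v_mem (hc n .g)) (Submodule.smul_mem _ _ (hc _ .g))

theorem vg_mem_stablePart : vg k ∈ stablePart k := by
  refine mem_stablePart.2 fun n i => ?_
  cases i with
  | v =>
    rcases n with _ | _ | n
    · exact L_zero_v_mem vg_mem
    · rw [zero_add, L_one_v_vg, L_zero_g_gg]
      exact sub_mem (Submodule.smul_mem _ _ vg_mem) (Submodule.smul_mem _ _ (sub_mem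
        (Submodule.smul_mem _ _ (gen_mem _)) (Submodule.smul_mem _ _ vg_mem)))
    · rw [L_v_vg _ (by omega)]; exact zero_mem _
  | g =>
    rcases n with _ | _ | n
    · rw [L_zero_g_vg]
      exact add_mem (Submodule.smul_mem _ _ (L_zero_g_gen_mem _))
        (Submodule.smul_mem _ _ (L_zero_v_mem gg_mem))
    · rw [zero_add, L_one_g_vg]; exact gg_mem
    · rw [L_g_vg _ (by omega)]; exact zero_mem _

theorem gg_mem_stablePart : gg k ∈ stablePart k := by
  refine mem_stablePart.2 fun n i => ?_
  cases i with
  | v =>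
    rcases n with _ | _ | n
    · exact L_zero_v_mem gg_mem
    · rw [zero_add, L_one_v_gg]; exact Submodule.smul_mem _ _ gg_mem
    · rw [L_v_gg _ (by omega)]; exact zero_mem _
  | g =>
    rcases n with _ | n
    · rw [L_zero_g_gg]
      exact sub_mem (Submodule.smul_mem _ _ (gen_mem _)) (Submodule.smul_mem _ _ vg_mem)
    · rw [L_g_gg _ (by omega)]; exact zero_mem _

theorem gen_mem_stablePart (j : K1Gen) : gen k j ∈ stablePart k := by
  refine mem_stablePart.2 fun n i => ?_
  cases j with
  | v =>
    cases i with
    | v =>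
      rcases n with _ | _ | _ | n
      · exact L_zero_v_mem (gen_mem _)
      · rw [zero_add, L_one_v_v]; exact sub_mem (gen_mem _) D_gg_mem
      · rw [zero_add, L_two_v_v]; exact Submodule.smul_mem _ _ gg_mem
      · rw [L_v_v _ (by omega)]; exact zero_mem _
    | g =>
      rcases n with _ | _ | n
      · exact L_zero_g_gen_mem _
      · rw [zero_add, L_one_g_v]; exact sub_mem (Submodule.smul_mem _ _ (gen_mem _)) vg_mem
      · rw [L_g_v _ (by omega)]; exact zero_mem _
  | g =>
    cases i with
    | v =>
      rcases n with _ | _ | n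
      · exact L_zero_v_mem (gen_mem _)
      · exact vg_mem
      · rw [L_v_g _ (by omega)]; exact zero_mem _
    | g =>
      rcases n with _ | _ | n
      · exact L_zero_g_gen_mem _
      · exact gg_mem
      · rw [L_g_g _ (by omega)]; exact zero_mem _

/-- The formulas for $\partial(v_{(1)}g)$ and $\partial(g_{(1)}g)$, read backwards, build these
elements from $v$, $g$, $v_{(1)}g$, $g_{(1)}g$ by $\partial$ and $L_0^v$, under which `stablePart`
is closed. -/
theorem L_zero_g_gen_mem_stablePart (i : K1Gen) : L k 0 .g (gen k i) ∈ stablePart k := by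
  cases i with
  | v =>
    have h : L k 0 .g (gen k .v) =
        L k 0 .v (gen k .g) + (1 / 2 : k) • del k (gen k .g) - del k (vg k) := by
      rw [D_vg]
      module
    rw [h]
    exact sub_mem (add_mem (L_zero_v_mem_stablePart (gen_mem_stablePart _))
      (Submodule.smul_mem _ _ (D_mem_stablePart (gen_mem_stablePart _))))
      (D_mem_stablePart vg_mem_stablePart)
  | g =>
    have h : L k 0 .g (gen k .g) = (1 / 2 : k) • del k (gg k) - (1 / 4 : k) • gen k .v := by
      rw [D_gg]
      module
    rw [h]
    exact sub_mem (Submodule.smul_mem _ _ (D_mem_stablePart gg_mem_stablePart))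
      (Submodule.smul_mem _ _ (gen_mem_stablePart _))

theorem wordSpan_le_stablePart : wordSpan k ≤ stablePart k := by
  refine Submodule.span_le.2 ?_
  rintro _ ⟨w, rfl⟩
  cases w with
  | plain n s x =>
    exact L_zero_v_pow_mem (fun _ => L_zero_v_mem_stablePart) n
      (D_pow_mem_stablePart (gen_mem_stablePart x) s)
  | withL0g n s x =>
    refine L_zero_v_pow_mem (fun _ => L_zero_v_mem_stablePart) n ?_
    rw [L_zero_D_pow]
    exact D_pow_mem_stablePart (L_zero_g_gen_mem_stablePart x) s
  | withL1 n x =>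
    refine L_zero_v_pow_mem (fun _ => L_zero_v_mem_stablePart) n ?_
    cases x with
    | v => exact vg_mem_stablePart
    | g => exact gg_mem_stablePart

theorem leftStabilizer_eq_top : leftStabilizer k = ⊤ :=
  Envelope.generates _
    (ι_mem_of_gen_mem (fun _ => D_mem_leftStabilizer) fun i n _ hc =>
      mem_stablePart.1 (wordSpan_le_stablePart hc) n i)
    (fun _ => D_mem_leftStabilizer) (fun n _ ha _ hb => nprod_mem_leftStabilizer ha hb n)

/-- The words span the envelope. -/
theorem wordSpan_eq_top : wordSpan k = ⊤ :=
  Envelope.generates _ (ι_mem_of_gen_mem (fun _ => D_mem) gen_mem) (fun _ => D_mem)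
    fun n a _ b hb => (leftStabilizer_eq_top (k := k) ▸ Submodule.mem_top : a ∈ leftStabilizer k) n b hb

end Spanning

end K1Envelope

/-! ### The words are linearly independent -/

namespace K1Word

variable (k : Type u) [Field k]

/-- The monomials `x^n ∂^s` of the words `(L_0^v)^n ∂^s y`, for a fixed generator `y`. -/
noncomputable def plainPart : K1Gen → K1Word → k[X][X]
  | .v, .plain n s .v => monomial s (monomial n 1)
  | .g, .plain n s .g => monomial s (monomial n 1)
  | _, _ => 0

/-- The monomials `x^n ∂^s` of the words `(L_0^v)^n L_0^g ∂^s y`, for a fixed generator `y`. -/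
noncomputable def withL0gPart : K1Gen → K1Word → k[X][X]
  | .v, .withL0g n s .v => monomial s (monomial n 1)
  | .g, .withL0g n s .g => monomial s (monomial n 1)
  | _, _ => 0

/-- The monomials `x^n` of the words `(L_0^v)^n L_1^y g`, for a fixed generator `y`. -/
noncomputable def withL1Part : K1Gen → K1Word → k[X]
  | .v, .withL1 n .v => monomial n 1
  | .g, .withL1 n .g => monomial n 1
  | _, _ => 0

variable {k}

theorem coeff_plainPart (y : K1Gen) (l : K1Word →₀ k) (n s : ℕ) :
    ((Finsupp.linearCombination k (plainPart k y) l).coeff s).coeff n = l (.plain n s y) := by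
  classical
  induction l using Finsupp.induction_linear with
  | zero => simp only [map_zero, coeff_zero, Finsupp.zero_apply]
  | add l l' h h' => rw [map_add, coeff_add, coeff_add, h, h', Finsupp.add_apply]
  | single w r =>
    rw [Finsupp.linearCombination_single, coeff_smul, coeff_smul, Finsupp.single_apply, smul_eq_mul]
    rcases w with ⟨n', s', y'⟩ | ⟨n', s', y'⟩ | ⟨n', y'⟩ <;> cases y <;> cases y' <;>
    simp only [plainPart, coeff_zero, mul_zero, reduceCtorEq, if_false, plain.injEq, and_false,
      and_true]
    all_goals
      rw [coeff_monomial]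
      by_cases hs : s' = s
      · simp [hs, coeff_monomial]
      · simp [hs]

theorem coeff_withL0gPart (y : K1Gen) (l : K1Word →₀ k) (n s : ℕ) :
    ((Finsupp.linearCombination k (withL0gPart k y) l).coeff s).coeff n = l (.withL0g n s y) := by
  classical
  induction l using Finsupp.induction_linear with
  | zero => simp only [map_zero, coeff_zero, Finsupp.zero_apply]
  | add l l' h h' => rw [map_add, coeff_add, coeff_add, h, h', Finsupp.add_apply]
  | single w r =>
    rw [Finsupp.linearCombination_single, coeff_smul, coeff_smul, Finsupp.single_apply, smul_eq_mul]
    rcases w with ⟨n', s', y'⟩ | ⟨n', s', y'⟩ | ⟨n', y'⟩ <;> cases y <;> cases y' <;>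
    simp only [withL0gPart, coeff_zero, mul_zero, reduceCtorEq, if_false, withL0g.injEq, and_false,
      and_true]
    all_goals
      rw [coeff_monomial]
      by_cases hs : s' = s
      · simp [hs, coeff_monomial]
      · simp [hs]

theorem coeff_withL1Part (y : K1Gen) (l : K1Word →₀ k) (n : ℕ) :
    (Finsupp.linearCombination k (withL1Part k y) l).coeff n = l (.withL1 n y) := by
  classical
  induction l using Finsupp.induction_linear with
  | zero => simp only [map_zero, coeff_zero, Finsupp.zero_apply]
  | add l l' h h' => rw [map_add, coeff_add, h, h', Finsupp.add_apply]
  | single w r =>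
    rw [Finsupp.linearCombination_single, coeff_smul, Finsupp.single_apply, smul_eq_mul]
    rcases w with ⟨n', s', y'⟩ | ⟨n', s', y'⟩ | ⟨n', y'⟩ <;> cases y <;> cases y' <;>
    simp only [withL1Part, coeff_zero, mul_zero, reduceCtorEq, if_false, withL1.injEq, and_false,
      and_true, coeff_monomial, mul_ite, mul_one]

theorem eq_zero_of_parts_eq_zero {l : K1Word →₀ k}
    (h₀ : ∀ y, Finsupp.linearCombination k (plainPart k y) l = 0)
    (h₁ : ∀ y, Finsupp.linearCombination k (withL0gPart k y) l = 0)
    (h₂ : ∀ y, Finsupp.linearCombination k (withL1Part k y) l = 0) : l = 0 := by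
  ext w
  rcases w with ⟨n, s, y⟩ | ⟨n, s, y⟩ | ⟨n, y⟩
  · rw [← coeff_plainPart, h₀, coeff_zero, coeff_zero, Finsupp.zero_apply]
  · rw [← coeff_withL0gPart, h₁, coeff_zero, coeff_zero, Finsupp.zero_apply]
  · rw [← coeff_withL1Part, h₂, coeff_zero, Finsupp.zero_apply]

end K1Word

namespace K1Envelope

/-! ### Images of the words: independence, injectivity and the range. -/

section Image

variable {k : Type u} [Field k]

theorem monomial_monomial_one (n s : ℕ) :
    (monomial s (monomial n 1) : k[X][X]) = C (X ^ n) * X ^ s := by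
  rw [C_mul_X_pow_eq_monomial, X_pow_eq_monomial]

/-- The absence of $\partial$ in the third family of words enters the independence proof through
this fact. -/
theorem eq_zero_of_X_mul_eq_C {p : k[X][X]} {a : k[X]} (h : X * p = C a) : p = 0 ∧ a = 0 := by
  have ha : a = 0 := by
    have := congrArg (fun f => coeff f 0) h
    simpa using this.symm
  rw [ha, C_0] at h
  exact ⟨(mul_eq_zero.1 h).resolve_left X_ne_zero, ha⟩

variable [CharZero k]

theorem toCend2_L_v (n : ℕ) (c : K1Envelope k) :
    toCend2 k (L k n .v c) = nprod k n (Cend2.v k) (toCend2 k c) := by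
  rw [L, (isConformalHom_toCend2 k).map_mul, toCend2_gen_v]

theorem toCend2_L_g (n : ℕ) (c : K1Envelope k) :
    toCend2 k (L k n .g c) = nprod k n (Cend2.g k) (toCend2 k c) := by
  rw [L, (isConformalHom_toCend2 k).map_mul, toCend2_gen_g]

theorem toCend2_L_zero_v_pow (n : ℕ) (c : K1Envelope k) :
    toCend2 k ((L k 0 .v ^ n) c) = (C (X ^ n) : k[X][X]) • toCend2 k c := by
  induction n with
  | zero => rw [pow_zero, pow_zero, C_1, one_smul, Module.End.one_apply]
  | succ n ih =>
    rw [pow_succ', Module.End.mul_apply, toCend2_L_v, ih, Cend2.v_nprod_zero, smul_smul, ← C_mul,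
      ← pow_succ']

theorem toCend2_D_pow (s : ℕ) (c : K1Envelope k) :
    toCend2 k (((del k : K1Envelope k →ₗ[k] K1Envelope k) ^ s) c) =
      (X ^ s : k[X][X]) • toCend2 k c := by
  induction s with
  | zero => rw [pow_zero, pow_zero, one_smul, Module.End.one_apply]
  | succ n ih =>
    rw [pow_succ', Module.End.mul_apply, (isConformalHom_toCend2 k).map_D, ih, Cend2.del_eq,
      smul_smul, ← pow_succ']

theorem toCend2_eval_plain (n s : ℕ) (y : K1Gen) : toCend2 k (K1Word.eval k (.plain n s y)) =
    (monomial s (monomial n 1) : k[X][X]) • toCend2 k (gen k y) := by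
  rw [K1Word.eval, toCend2_L_zero_v_pow, toCend2_D_pow, smul_smul, monomial_monomial_one]

theorem toCend2_eval_withL0g (n s : ℕ) (y : K1Gen) : toCend2 k (K1Word.eval k (.withL0g n s y)) =
    (monomial s (monomial n 1) : k[X][X]) • toCend2 k (L k 0 .g (gen k y)) := by
  rw [K1Word.eval, toCend2_L_zero_v_pow, L_zero_D_pow, toCend2_D_pow, smul_smul,
    monomial_monomial_one]

theorem toCend2_eval_withL1 (n : ℕ) (y : K1Gen) : toCend2 k (K1Word.eval k (.withL1 n y)) =
    (C (monomial n 1) : k[X][X]) • toCend2 k (L k 1 y (gen k .g)) := by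
  rw [K1Word.eval, toCend2_L_zero_v_pow, X_pow_eq_monomial]

/-- The coefficients of a combination are gathered into six polynomials, one for each family and
each generator. -/
theorem toCend2_linearCombination (l : K1Word →₀ k) :
    toCend2 k (Finsupp.linearCombination k (K1Word.eval k) l) =
      Finsupp.linearCombination k (K1Word.plainPart k .v) l • toCend2 k (gen k .v) +
      Finsupp.linearCombination k (K1Word.plainPart k .g) l • toCend2 k (gen k .g) +
      Finsupp.linearCombination k (K1Word.withL0gPart k .v) l • toCend2 k (L k 0 .g (gen k .v)) +
      Finsupp.linearCombination k (K1Word.withL0gPart k .g) l • toCend2 k (L k 0 .g (gen k .g)) +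
      (C (Finsupp.linearCombination k (K1Word.withL1Part k .v) l) : k[X][X]) •
        toCend2 k (L k 1 .v (gen k .g)) +
      (C (Finsupp.linearCombination k (K1Word.withL1Part k .g) l) : k[X][X]) •
        toCend2 k (L k 1 .g (gen k .g)) := by
  induction l using Finsupp.induction_linear with
  | zero => simp only [map_zero, zero_smul, add_zero]
  | add l l' h h' =>
    simp only [map_add, h, h']
    module
  | single w r =>
    simp only [Finsupp.linearCombination_single, map_smul, ← smul_C, smul_assoc, ← smul_add]
    congr 1
    rcases w with ⟨n, s, y⟩ | ⟨n, s, y⟩ | ⟨n, y⟩ <;> cases y <;>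
    simp only [toCend2_eval_plain, toCend2_eval_withL0g, toCend2_eval_withL1, K1Word.plainPart,
      K1Word.withL0gPart, K1Word.withL1Part, C_0, zero_smul, add_zero, zero_add]

theorem toCend2_linearCombination_eq (l : K1Word →₀ k) {p q r t : k[X][X]} {a b : k[X]}
    (hp : Finsupp.linearCombination k (K1Word.plainPart k .v) l = p)
    (hq : Finsupp.linearCombination k (K1Word.plainPart k .g) l = q)
    (hr : Finsupp.linearCombination k (K1Word.withL0gPart k .v) l = r)
    (ht : Finsupp.linearCombination k (K1Word.withL0gPart k .g) l = t)
    (ha : Finsupp.linearCombination k (K1Word.withL1Part k .v) l = a)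
    (hb : Finsupp.linearCombination k (K1Word.withL1Part k .g) l = b) :
    toCend2 k (Finsupp.linearCombination k (K1Word.eval k) l) =
      !![C X * (p - (1 / 4 : k) • t),
          C X * (1 / 2 : k) • (q + r * (C X - (1 / 2 : k) • X) + C a);
        (-1 / 2 : k) • (q + C X * r + (1 / 2 : k) • C a),
          (C X - (1 / 2 : k) • X) * p - (1 / 4 : k) • (C X * t) - (1 / 4 : k) • C b] := by
  rw [toCend2_linearCombination, hp, hq, hr, ht, ha, hb, toCend2_L_g, toCend2_L_g, toCend2_L_g,
    toCend2_L_v, toCend2_gen_v, toCend2_gen_g, Cend2.g_nprod_zero_v, Cend2.g_nprod_zero_g,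
    Cend2.v_nprod_one_g, Cend2.g_nprod_one_g, Cend2.v_eq, Cend2.g_eq]
  ext1 i j
  fin_cases i <;> fin_cases j <;>
  simp only [Matrix.smul_apply, Matrix.add_apply, smul_eq_mul, Fin.zero_eta, Fin.mk_one,
    Matrix.of_apply, Matrix.cons_val', Matrix.cons_val_zero, Matrix.cons_val_one,
    Matrix.cons_val_fin_one] <;> algebra with k

/-- The factors $x$ in the top row cancel. Eliminating $t$ from the diagonal entries gives
$-2\partial p=b(x)$, and eliminating $q$ from the off-diagonal ones gives $\partial r=a(x)$; each
forces both of its sides to vanish, and then $t=q=0$. -/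
theorem injective_toCend2_linearCombination : Function.Injective
    (toCend2 k ∘ₗ Finsupp.linearCombination k (K1Word.eval k)) := by
  refine (injective_iff_map_eq_zero _).2 fun l hl => ?_
  rw [LinearMap.comp_apply, toCend2_linearCombination_eq l rfl rfl rfl rfl rfl rfl] at hl
  have h₀₀ := congrFun (congrFun hl 0) 0
  have h₀₁ := congrFun (congrFun hl 0) 1
  have h₁₀ := congrFun (congrFun hl 1) 0
  have h₁₁ := congrFun (congrFun hl 1) 1
  clear hl
  simp only [Matrix.of_apply, Matrix.cons_val', Matrix.cons_val_zero, Matrix.cons_val_one,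
    Matrix.cons_val_fin_one, Matrix.zero_apply] at h₀₀ h₀₁ h₁₀ h₁₁
  have hx : (C X : k[X][X]) ≠ 0 := C_ne_zero.2 X_ne_zero
  replace h₀₀ := (mul_eq_zero.1 h₀₀).resolve_left hx
  replace h₀₁ := (mul_eq_zero.1 h₀₁).resolve_left hx
  suffices (∀ y, Finsupp.linearCombination k (K1Word.plainPart k y) l = 0) ∧
      (∀ y, Finsupp.linearCombination k (K1Word.withL0gPart k y) l = 0) ∧
      ∀ y, Finsupp.linearCombination k (K1Word.withL1Part k y) l = 0 from
    K1Word.eq_zero_of_parts_eq_zero this.1 this.2.1 this.2.2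
  generalize hp : Finsupp.linearCombination k (K1Word.plainPart k .v) l = p at *
  generalize hq : Finsupp.linearCombination k (K1Word.plainPart k .g) l = q at *
  generalize hr : Finsupp.linearCombination k (K1Word.withL0gPart k .v) l = r at *
  generalize ht : Finsupp.linearCombination k (K1Word.withL0gPart k .g) l = t at *
  generalize ha : Finsupp.linearCombination k (K1Word.withL1Part k .v) l = a at *
  generalize hb : Finsupp.linearCombination k (K1Word.withL1Part k .g) l = b at *
  have h₁ : X * ((-2 : k) • p) = C b := by
    have h : X * ((-2 : k) • p) - C b = (4 : k) • ((C X - (1 / 2 : k) • X) * p -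
        (1 / 4 : k) • (C X * t) - (1 / 4 : k) • C b) - (4 : k) • (C X * (p - (1 / 4 : k) • t)) := by
      algebra with k
    rw [← sub_eq_zero, h, h₁₁, h₀₀, mul_zero, smul_zero, sub_zero]
  have h₂ : X * r = C a := by
    have h : X * r - C a = (-4 : k) • ((1 / 2 : k) • (q + r * (C X - (1 / 2 : k) • X) + C a)) -
        (4 : k) • ((-1 / 2 : k) • (q + C X * r + (1 / 2 : k) • C a)) := by
      algebra with k
    rw [← sub_eq_zero, h, h₁₀, h₀₁, smul_zero, smul_zero, sub_zero]
  obtain ⟨hp0, rfl⟩ := eq_zero_of_X_mul_eq_C h₁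
  obtain ⟨rfl, rfl⟩ := eq_zero_of_X_mul_eq_C h₂
  obtain rfl : p = 0 := (smul_eq_zero.1 hp0).resolve_left (by norm_num)
  obtain rfl : t = 0 := (smul_eq_zero.1 (by rwa [zero_sub, neg_eq_zero] at h₀₀)).resolve_left
    (by norm_num : (1 / 4 : k) ≠ 0)
  obtain rfl : q = 0 := by
    rw [zero_mul, C_0, add_zero, add_zero] at h₀₁
    exact (smul_eq_zero.1 h₀₁).resolve_left (by norm_num)
  refine ⟨?_, ?_, ?_⟩ <;> rintro (_ | _) <;> assumption

variable (k) in
theorem linearIndependent_words : LinearIndependent k (K1Word.eval k) :=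
  Function.Injective.of_comp (f := toCend2 k) injective_toCend2_linearCombination

theorem exists_linearCombination_eq (c : K1Envelope k) :
    ∃ l, Finsupp.linearCombination k (K1Word.eval k) l = c := by
  have h : c ∈ wordSpan k := wordSpan_eq_top (k := k) ▸ Submodule.mem_top
  exact (Finsupp.mem_span_range_iff_exists_finsupp).1 h

variable (k) in
theorem injective_toCend2 : Function.Injective (toCend2 k) := by
  intro c c' h
  obtain ⟨l, rfl⟩ := exists_linearCombination_eq c
  obtain ⟨l', rfl⟩ := exists_linearCombination_eq c'
  rw [injective_toCend2_linearCombination h]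

/-- The range is a $\Bbbk[\partial,x]$-module, since multiplication by $x$ and by $\partial$ is
realized by $L_0^v$ and `del`. -/
theorem smul_mem_range_toCend2 (p : k[X][X]) (A : Cend2 k) (hA : A ∈ LinearMap.range (toCend2 k)) :
    p • A ∈ LinearMap.range (toCend2 k) := by
  induction p using bivariate_induction generalizing A with
  | hC a =>
    rw [← mul_one (C (C a)), ← smul_eq_C_C_mul, smul_assoc, one_smul]
    exact Submodule.smul_mem _ a hA
  | hx =>
    obtain ⟨c, rfl⟩ := hA
    exact ⟨L k 0 .v c, by rw [toCend2_L_v, Cend2.v_nprod_zero]⟩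
  | hX =>
    obtain ⟨c, rfl⟩ := hA
    exact ⟨del k c, by rw [(isConformalHom_toCend2 k).map_D, Cend2.del_eq]⟩
  | hadd f g hf hg => rw [add_smul]; exact add_mem (hf A hA) (hg A hA)
  | hmul f g hf hg => rw [mul_smul]; exact hf _ (hg A hA)

variable (k) in
theorem range_toCend2 : Set.range (toCend2 k) =
    {A : Cend2 k | ∃ f₁₁ f₁₂ f₂₁ f₂₂ : Polynomial (Polynomial k),
        A = !![Polynomial.C Polynomial.X * f₁₁, Polynomial.C Polynomial.X * f₁₂; f₂₁, f₂₂]} := by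
  ext A
  constructor
  · rintro ⟨c, rfl⟩
    obtain ⟨l, rfl⟩ := exists_linearCombination_eq c
    exact ⟨_, _, _, _, toCend2_linearCombination_eq l rfl rfl rfl rfl rfl rfl⟩
  · rintro ⟨a, b, c, d, rfl⟩
    -- The coefficient of $v$ is read from the upper left entry, and
    -- $g_{(1)}g\mapsto\mathrm{diag}(0,-\frac14)$ corrects the lower right one. The coefficients
    -- $\alpha$ of $g$ and $\beta$ of $v_{(1)}g$ solve $\frac12\alpha+\frac12\beta=b$,
    -- $-\frac12\alpha-\frac14\beta=c$.
    have h : (!![C X * a, C X * b; c, d] : Cend2 k) =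
        a • toCend2 k (gen k .v) + ((-4 : k) • c - (2 : k) • b) • toCend2 k (gen k .g) +
        ((4 : k) • b + (4 : k) • c) • toCend2 k (L k 1 .v (gen k .g)) +
        ((-4 : k) • (d - (C X - (1 / 2 : k) • X) * a)) • toCend2 k (L k 1 .g (gen k .g)) := by
      rw [toCend2_L_g, toCend2_L_v, toCend2_gen_v, toCend2_gen_g, Cend2.v_nprod_one_g,
        Cend2.g_nprod_one_g, Cend2.v_eq, Cend2.g_eq]
      ext1 i j
      fin_cases i <;> fin_cases j <;>
      simp only [Matrix.smul_apply, Matrix.add_apply, smul_eq_mul, Fin.zero_eta, Fin.mk_one,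
        Matrix.of_apply, Matrix.cons_val', Matrix.cons_val_zero, Matrix.cons_val_one,
        Matrix.cons_val_fin_one] <;> algebra with k
    rw [h]
    change _ ∈ LinearMap.range (toCend2 k)
    refine add_mem (add_mem (add_mem ?_ ?_) ?_) ?_ <;>
    exact smul_mem_range_toCend2 _ _ ⟨_, rfl⟩

end Image

/-! ### The presented algebra is an envelope. -/

section Universal

variable (k : Type u) [Field k]

theorem parity_sup_parity : (parity k 0 ⊔ parity k 1 : Submodule k (K1Envelope k)) = ⊤ := by
  refine Envelope.generates _ (fun a => ?_) (fun c hc => ?_) fun n c hc c' hc' => ?_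
  · obtain ⟨b, hb, c, hc, rfl⟩ := K1.exists_add a
    rw [map_add]
    exact Submodule.add_mem_sup (Envelope.ι_mem 0 b hb) (Envelope.ι_mem 1 c hc)
  · obtain ⟨a, ha, b, hb, rfl⟩ := Submodule.mem_sup.1 hc
    rw [map_add]
    exact Submodule.add_mem_sup (Envelope.D_mem 0 a ha) (Envelope.D_mem 1 b hb)
  · obtain ⟨a, ha, b, hb, rfl⟩ := Submodule.mem_sup.1 hc
    obtain ⟨a', ha', b', hb', rfl⟩ := Submodule.mem_sup.1 hc'
    rw [map_add, map_add, LinearMap.add_apply, LinearMap.add_apply]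
    refine add_mem (add_mem ?_ ?_) (add_mem ?_ ?_)
    · exact Submodule.mem_sup_left (Envelope.mul_mem 0 0 n _ _ ha ha')
    · exact Submodule.mem_sup_right (Envelope.mul_mem 1 0 n _ _ hb ha')
    · exact Submodule.mem_sup_right (Envelope.mul_mem 0 1 n _ _ ha hb')
    · exact Submodule.mem_sup_left (Envelope.mul_mem 1 1 n _ _ hb hb')

variable [CharZero k]

/-- Locality of arbitrary pairs and directness of the grading are not among the relations; both are
pulled back along the injection into `Cend2`. -/
theorem isAssocConformal : IsAssocConformal k (K1Envelope k) where
  locality x y := by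
    obtain ⟨M, hM⟩ := (Cend2.isAssocConformal k).locality (toCend2 k x) (toCend2 k y)
    refine ⟨M, fun n hn => injective_toCend2 k ?_⟩
    rw [(isConformalHom_toCend2 k).map_mul, hM n hn, map_zero]
  D_mul := Envelope.D_mul
  mul_D := Envelope.mul_D
  isCompl := by
    refine IsCompl.of_eq ((Submodule.eq_bot_iff _).2 ?_) (parity_sup_parity k)
    rintro c ⟨h₀, h₁⟩
    refine injective_toCend2 k ?_
    rw [map_zero]
    exact (Submodule.disjoint_def.1 Cend2.isCompl_parity.disjoint) _
      ((isConformalHom_toCend2 k).map_parity 0 c h₀) ((isConformalHom_toCend2 k).map_parity 1 c h₁)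
  D_mem := Envelope.D_mem
  mul_mem := Envelope.mul_mem
  assoc := Envelope.assoc

theorem toCend2_curly (n : ℕ) (x y : K1Envelope k) :
    toCend2 k (curly k n x y) = curly k n (toCend2 k x) (toCend2 k y) := by
  have hf := isConformalHom_toCend2 k
  have hD (s : ℕ) (c : K1Envelope k) : toCend2 k (((del k : K1Envelope k →ₗ[k] _) ^ s) c) =
      ((del k : Cend2 k →ₗ[k] _) ^ s) (toCend2 k c) := by
    induction s with
    | zero => rfl
    | succ s ih =>
      rw [pow_succ', Module.End.mul_apply, hf.map_D, ih, pow_succ', Module.End.mul_apply]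
  obtain ⟨M, hM⟩ := (isAssocConformal k).locality x y
  rw [curly_eq_sum (M := M) fun m hm => hM m (by omega), curly_eq_sum (M := M) fun m hm => by
    rw [← hf.map_mul, hM m (by omega), map_zero], map_sum]
  simp only [map_smul, hD, hf.map_mul]

theorem isEnvelope : IsEnvelope k (K1.gen k) K1Gen.N (K1Envelope.ι k) where
  assoc := isAssocConformal k
  map_D := Envelope.ι_D
  map_parity := Envelope.ι_mem
  -- The relations give the commutator formula for generators only; for all elements it is checked
  -- after the injection, where it holds by `Cend2.rep_bracket`.
  map_bracket i j n a b ha hb := injective_toCend2 k <| by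
    rw [map_sub, map_smul, toCend2_curly, (isConformalHom_toCend2 k).map_mul, toCend2_ι, toCend2_ι,
      toCend2_ι]
    exact Cend2.rep_bracket i j n a b ha hb
  generates := Envelope.generates
  locality := Envelope.locality_gen

/-- The words form a basis of the envelope. -/
noncomputable def wordBasis : Module.Basis K1Word k (K1Envelope k) :=
  Module.Basis.mk (linearIndependent_words k) (wordSpan_eq_top (k := k)).ge

end Universal

end K1Envelope

/-- Linear basis of `U(K₁; {v, g}, N)` and its realization in `Cend₂`. -/
theorem mainTheorem6 (k : Type u) [Field k] [CharZero k] :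
    IsUniversalEnvelope k (K1.gen k) K1Gen.N (K1Envelope.ι k) ∧
    (∃ b : Module.Basis K1Word k (K1Envelope k), ∀ w, b w = w.eval k) ∧
    ∃ f : K1Envelope k →ₗ[k] Cend2 k, IsConformalHom k f ∧
      f (K1Envelope.gen k .v) = Cend2.v k ∧ f (K1Envelope.gen k .g) = Cend2.g k ∧
      Function.Injective f ∧
      Set.range f = {A : Cend2 k | ∃ f₁₁ f₁₂ f₂₁ f₂₂ : Polynomial (Polynomial k),
        A = !![Polynomial.C Polynomial.X * f₁₁, Polynomial.C Polynomial.X * f₁₂; f₂₁, f₂₂]} :=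
  ⟨Envelope.isUniversalEnvelope K1.gen_mem_parity (K1Envelope.isEnvelope k),
    ⟨K1Envelope.wordBasis k, fun w => Module.Basis.mk_apply _ _ w⟩,
    K1Envelope.toCend2 k, K1Envelope.isConformalHom_toCend2 k, K1Envelope.toCend2_gen_v k,
    K1Envelope.toCend2_gen_g k, K1Envelope.injective_toCend2 k, K1Envelope.range_toCend2 k⟩
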